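/- Let $n\ge 1$, $\rho>0$, $1\le p<\infty$, and let $\Delta=-\sum_{j=1}^n\partial^2/\partial x_j^2$ on $\mathbb{R}^n$. Put $\gamma_p=\left|\tfrac2p-1\right|$ and $\tilde K_\nu(z)=z^\nu K_\nu(z)$, where $$K_\nu(z)=\tfrac12\Big(\tfrac z2\Big)^\nu\int_0^\infty e^{-(t+\frac{z^2}{4t})}\,t^{-\nu-1}\,dt\qquad(\nu>0,\ z>0),$$ and let $L^p_\rho(\mathbb{R}^n)=L^p\big(\mathbb{R}^n,(\tilde K_{n/2}(\rho|x|))^{\gamma_p p}\,dx\big)$ (complex-valued functions). For $W>0$ let $\Omega_W=\{\lambda\in\mathbb{C}:|\operatorname{Im}\lambda|<W\}$, and let $\mathfrak{S}_W^{-\infty}$ be the set of all even holomorphic functions $\varphi$ on $\Omega_W$ such that for every $m\in\mathbb{R}$ and every $j=0,1,2,\dots$ there is a constant $C_{j,m}$ with $$|\varphi^{(j)}(\lambda)|\le C_{j,m}\,(1+|\lambda|^2)^{\frac{m-j}2}\qquad\text{for all }\lambda\in\Omega_W$$ (equivalently, on $\overline{\Omega}_W$, to which all the $\varphi^{(j)}$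 then extend continuously). Let $\varphi(\sqrt\Delta)$ be the operator on $L^2(\mathbb{R}^n)$ given by the functional calculus, that is, with $\hat f(\xi)=(2\pi)^{-n/2}\int f(x)e^{-ix\cdot\xi}\,dx$, $$\widehat{\varphi(\sqrt\Delta)f}(\xi)=\varphi(|\xi|)\,\hat f(\xi).$$ If $\varphi\in\mathfrak{S}_W^{-\infty}$ with $W>0$ and $W\ge\gamma_p\rho$, then $\varphi(\sqrt\Delta)$ is bounded on $L^p_\rho(\mathbb{R}^n)$: $\varphi(\sqrt\Delta)f$ is defined for every $f\in L^2(\mathbb{R}^n)\cap L^p_\rho(\mathbb{R}^n)$, and there is exactly one bounded linear operator $T:L^p_\rho(\mathbb{R}^n)\to L^p_\rho(\mathbb{R}^n)$ such that $Tf=\varphi(\sqrt\Delta)f$ almost everywhere for all $f\in L^2(\mathbb{R}^n)\cap L^p_\rho(\mathbb{R}^n)$. -/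

import Mathlib

open MeasureTheory Set FourierTransform
open scoped ENNReal

noncomputable section

namespace WeightedMultiplier

/-- The Macdonald function `K_ν(z)` for `ν > 0`, `z > 0`, given by the Sommerfeld integral. -/
def macdonaldK (ν z : ℝ) : ℝ :=
  1 / 2 * (z / 2) ^ ν * ∫ t in Ioi (0 : ℝ), Real.exp (-(t + z ^ 2 / (4 * t))) * t ^ (-ν - 1)

/-- `K̃_ν(z) = z ^ ν * K_ν(z)`. -/
def macdonaldKTilde (ν z : ℝ) : ℝ :=
  z ^ ν * macdonaldK ν z

/-- `γ_p = |2 / p - 1|`, for a finite exponent `p`. -/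
def gammaExp (p : ℝ≥0∞) : ℝ :=
  |2 / p.toReal - 1|

/-- The weight `(K̃_{n/2}(ρ |x|)) ^ (γ_p p)` on `ℝⁿ`.  Its value at the single point `x = 0` is
immaterial, since that point is a null set in `ℝⁿ`, `n ≥ 1`. -/
def weight (n : ℕ) (ρ : ℝ) (p : ℝ≥0∞) (x : EuclideanSpace ℝ (Fin n)) : ℝ :=
  (macdonaldKTilde ((n : ℝ) / 2) (ρ * ‖x‖)) ^ (gammaExp p * p.toReal)

/-- The measure `(K̃_{n/2}(ρ |x|)) ^ (γ_p p) dx`; the space `L^p_ρ(ℝⁿ)` is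
`Lp ℂ p (weightedMeasure n ρ p)`. -/
def weightedMeasure (n : ℕ) (ρ : ℝ) (p : ℝ≥0∞) : Measure (EuclideanSpace ℝ (Fin n)) :=
  volume.withDensity fun x => ENNReal.ofReal (weight n ρ p x)

/-- The open strip `Ω_W = {λ ∈ ℂ : |Im λ| < W}`. -/
def strip (W : ℝ) : Set ℂ :=
  {z | |z.im| < W}

/-- The symbol class `𝔖_W^m`: even holomorphic functions `φ` on `Ω_W` with
`|φ^{(j)}(λ)| ≤ C_j (1 + |λ|²)^{(m - j) / 2}` for every `j`.  Imposing the bounds on the open strip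
is the same as imposing them on its closure: the derivative of order `j` is Lipschitz on bounded
parts of the (convex) strip, by the bound for `j + 1`, so that it extends continuously to the
closure, and the bound passes to the extension. -/
structure IsSymbol (W m : ℝ) (φ : ℂ → ℂ) : Prop where
  holomorphic : DifferentiableOn ℂ φ (strip W)
  even : ∀ z ∈ strip W, φ (-z) = φ z
  bound : ∀ j : ℕ, ∃ C : ℝ, ∀ z ∈ strip W,
    ‖iteratedDeriv j φ z‖ ≤ C * (1 + ‖z‖ ^ 2) ^ ((m - j) / 2)

/-- The symbol class `𝔖_W^{-∞}`, the intersection of all the classes `𝔖_W^m`, `m ∈ ℝ`. -/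
def IsSymbolNegInfty (W : ℝ) (φ : ℂ → ℂ) : Prop :=
  ∀ m : ℝ, IsSymbol W m φ

/-- The maximal domain `{f ∈ L² : a f ∈ L²}` of multiplication by a function `a` on `L²(ℝⁿ)`. -/
def mulDomain (n : ℕ) (a : EuclideanSpace ℝ (Fin n) → ℂ) :
    Submodule ℂ (Lp ℂ 2 (volume : Measure (EuclideanSpace ℝ (Fin n)))) where
  carrier := {f | MemLp (fun ξ => a ξ * f ξ) 2 volume}
  add_mem' := by
    intro f g hf hg
    refine (MemLp.add hf hg).ae_eq ?_
    filter_upwards [Lp.coeFn_add f g] with ξ h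
    simp only [h, Pi.add_apply, mul_add]
  zero_mem' := by
    refine (MemLp.zero (ε := ℂ)).ae_eq ?_
    filter_upwards [Lp.coeFn_zero ℂ 2 (volume : Measure (EuclideanSpace ℝ (Fin n)))] with ξ h
    simp only [h, Pi.zero_apply, mul_zero]
  smul_mem' := by
    intro c f hf
    refine (MemLp.const_smul hf c).ae_eq ?_
    filter_upwards [Lp.coeFn_smul c f] with ξ h
    simp only [h, Pi.smul_apply, smul_eq_mul]
    ring

theorem toLp_mul_add (n : ℕ) (a : EuclideanSpace ℝ (Fin n) → ℂ)
    (f g : Lp ℂ 2 (volume : Measure (EuclideanSpace ℝ (Fin n))))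
    (hf : MemLp (fun ξ => a ξ * f ξ) 2 volume) (hg : MemLp (fun ξ => a ξ * g ξ) 2 volume)
    (h : MemLp (fun ξ => a ξ * (f + g) ξ) 2 volume) :
    h.toLp = hf.toLp + hg.toLp := by
  apply Lp.ext
  filter_upwards [h.coeFn_toLp, hf.coeFn_toLp, hg.coeFn_toLp, Lp.coeFn_add f g,
    Lp.coeFn_add hf.toLp hg.toLp] with ξ h1 h2 h3 h4 h5
  rw [h1, h5, Pi.add_apply, h2, h3, h4, Pi.add_apply, mul_add]

theorem toLp_mul_smul (n : ℕ) (a : EuclideanSpace ℝ (Fin n) → ℂ) (c : ℂ)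
    (f : Lp ℂ 2 (volume : Measure (EuclideanSpace ℝ (Fin n))))
    (hf : MemLp (fun ξ => a ξ * f ξ) 2 volume)
    (h : MemLp (fun ξ => a ξ * (c • f) ξ) 2 volume) :
    h.toLp = c • hf.toLp := by
  apply Lp.ext
  filter_upwards [h.coeFn_toLp, hf.coeFn_toLp, Lp.coeFn_smul c f,
    Lp.coeFn_smul c hf.toLp] with ξ h1 h2 h4 h5
  rw [h1, h5, Pi.smul_apply, h2, h4, Pi.smul_apply, smul_eq_mul, smul_eq_mul]
  ring

/-- Multiplication by a function `a` on `L²(ℝⁿ)`, on its maximal domain. -/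
def mulOp (n : ℕ) (a : EuclideanSpace ℝ (Fin n) → ℂ) :
    mulDomain n a →ₗ[ℂ] Lp ℂ 2 (volume : Measure (EuclideanSpace ℝ (Fin n))) where
  toFun := fun f => MemLp.toLp (fun ξ => a ξ * f.1 ξ) f.2
  map_add' := by
    rintro ⟨f, hf⟩ ⟨g, hg⟩
    exact toLp_mul_add n a f g hf hg _
  map_smul' := by
    rintro c ⟨f, hf⟩
    exact toLp_mul_smul n a c f hf _

/-- The operator `φ(√Δ)` on `L²(ℝⁿ)`, for the (positive) Laplacian `Δ = -∑ ∂²/∂x_j²`, through the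
functional calculus.  The Fourier transform `𝓕 f(ξ) = ∫ f(x) exp(-2πi x·ξ) dx` is unitary on `L²`
and turns `Δ` into multiplication by `(2π|ξ|)²`, hence `√Δ` into multiplication by `2π|ξ|`, and
`φ(√Δ) = 𝓕⁻¹ ∘ (multiplication by φ(2π|ξ|)) ∘ 𝓕`, with domain
`{f ∈ L² : φ(2π|ξ|) 𝓕 f(ξ) ∈ L²}`. -/
def funcSqrtLaplacian (n : ℕ) (φ : ℂ → ℂ) :
    Lp ℂ 2 (volume : Measure (EuclideanSpace ℝ (Fin n))) →ₗ.[ℂ]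
      Lp ℂ 2 (volume : Measure (EuclideanSpace ℝ (Fin n))) where
  domain := (mulDomain n fun ξ => φ ((2 * Real.pi * ‖ξ‖ : ℝ) : ℂ)).comap
    (Lp.fourierTransformₗᵢ (EuclideanSpace ℝ (Fin n)) ℂ).toLinearEquiv.toLinearMap
  toFun :=
    (Lp.fourierTransformₗᵢ (EuclideanSpace ℝ (Fin n)) ℂ).symm.toLinearEquiv.toLinearMap ∘ₗ
      mulOp n (fun ξ => φ ((2 * Real.pi * ‖ξ‖ : ℝ) : ℂ)) ∘ₗ
        (Lp.fourierTransformₗᵢ (EuclideanSpace ℝ (Fin n)) ℂ).toLinearEquiv.toLinearMap.submoduleComap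
          (mulDomain n fun ξ => φ ((2 * Real.pi * ‖ξ‖ : ℝ) : ℂ))

end WeightedMultiplier

end

/-!
The operator `φ(√Δ)` is convolution with the radial kernel `k = 𝓕⁻¹ (φ(2π|ξ|))`.  Its boundedness on
`L^p_ρ` comes from two estimates whose exponential rates match, even when `W = γ_p ρ`.

* The kernel satisfies `|k(x)| ≤ C_N (1 + |x|)^{-N} exp(-W|x|)` for every `N`
  (`pow_mul_norm_fourierInv_symbol_le`).  An even symbol is `φ(λ) = ψ(λ²)` with `ψ` holomorphic
  inside a parabola, where all the derivatives of `ψ` decrease rapidly (`rapidDecay_compSqrt`), so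
  that `ψ(ξ · ξ)` extends to complex `ξ` with `|Im ξ| < W`.  For a unit vector `u` the integral of
  `(ξ · u)^a ψ(ξ · ξ) exp(i r ξ · u)` is unchanged under `ξ ↦ ξ + τ u`, for real `τ` by translation
  invariance and then for complex `τ` by the identity theorem (`integral_complex_translate`).
  Imaginary `τ` yields the factor `exp(-W r)`; the vanishing of the derivative in `τ` is an
  integration by parts, which stays in this family of integrals and gains a power of `r` each time
  (`pow_mul_norm_oscIntegral_le`).
* The weight satisfies `K̃_{n/2}(a) ≤ exp|a - b| K̃_{n/2}(b)` (`macdonaldKTilde_le_exp_mul`):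
  `K̃_ν(z)` is decreasing and `exp(z) K̃_ν(z)` is nondecreasing for `ν = n/2 ≥ 1/2`.  After a
  substitution, `K̃_ν(z)` is a multiple of `∫ exp(-(s + z²/(4s))) s^{ν-1} ds`; for `ν ≥ 1` a shift of
  `s` suffices, and for `ν = 1/2` the function is a multiple of `exp(-z)`.

Hence the weight is absorbed into the integrable kernel `|k(x)| exp(W|x|)`, and a weighted form of
Young's inequality bounds the convolution (`exists_convolution_operator`).  On `L²` the convolution
is the functional calculus: this is Fubini's theorem for Schwartz functions, and density otherwise
(`funcSqrtLaplacian_ae_eq_conv`).  Uniqueness holds because Schwartz functions lie in `L²` and are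
dense in `L^p_ρ`.
-/

namespace WeightedMultiplier

/-! ### Rapidly decreasing holomorphic functions -/

/-- `RapidDecay S k f`: the function `f` and its first `k` complex derivatives decrease faster than
every power of `1 + ‖z‖` on `S`, uniformly up to the boundary of `S`, and the derivatives of order
less than `k` are holomorphic on `S`. -/
def RapidDecay (S : Set ℂ) : ℕ → (ℂ → ℂ) → Prop
  | 0, f => ∀ M : ℕ, ∃ C : ℝ, ∀ z ∈ S, ‖f z‖ * (1 + ‖z‖) ^ M ≤ C
  | k + 1, f => (∀ M : ℕ, ∃ C : ℝ, ∀ z ∈ S, ‖f z‖ * (1 + ‖z‖) ^ M ≤ C) ∧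
      DifferentiableOn ℂ f S ∧ RapidDecay S k (deriv f)

namespace RapidDecay

variable {S T : Set ℂ} {f g : ℂ → ℂ} {k : ℕ}

theorem bound (h : RapidDecay S k f) (M : ℕ) :
    ∃ C : ℝ, ∀ z ∈ S, ‖f z‖ * (1 + ‖z‖) ^ M ≤ C := by
  cases k with
  | zero => exact h M
  | succ k => exact h.1 M

theorem of_succ (h : RapidDecay S (k + 1) f) : RapidDecay S k f := by
  induction k generalizing f with
  | zero => exact h.1
  | succ k ih => exact ⟨h.1, h.2.1, ih h.2.2⟩

theorem congr (hS : IsOpen S) (h : RapidDecay S k f) (hfg : EqOn f g S) : RapidDecay S k g := by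
  induction k generalizing f g with
  | zero =>
    intro M
    obtain ⟨C, hC⟩ := h M
    exact ⟨C, fun z hz => hfg hz ▸ hC z hz⟩
  | succ k ih =>
    refine ⟨fun M => ?_, h.2.1.congr fun z hz => (hfg hz).symm, ih h.2.2 (hfg.deriv hS)⟩
    obtain ⟨C, hC⟩ := h.1 M
    exact ⟨C, fun z hz => hfg hz ▸ hC z hz⟩

theorem mono (h : RapidDecay S k f) (hT : T ⊆ S) : RapidDecay T k f := by
  induction k generalizing f with
  | zero =>
    intro M
    obtain ⟨C, hC⟩ := h M
    exact ⟨C, fun z hz => hC z (hT hz)⟩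
  | succ k ih =>
    refine ⟨fun M => ?_, h.2.1.mono hT, ih h.2.2⟩
    obtain ⟨C, hC⟩ := h.1 M
    exact ⟨C, fun z hz => hC z (hT hz)⟩

theorem union (hS : IsOpen S) (hT : IsOpen T) (h : RapidDecay S k f) (h' : RapidDecay T k f) :
    RapidDecay (S ∪ T) k f := by
  have key : ∀ {k : ℕ} {f : ℂ → ℂ}, RapidDecay S k f → RapidDecay T k f →
      ∀ M : ℕ, ∃ C : ℝ, ∀ z ∈ S ∪ T, ‖f z‖ * (1 + ‖z‖) ^ M ≤ C := by
    intro k f h h' M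
    obtain ⟨C, hC⟩ := h.bound M
    obtain ⟨C', hC'⟩ := h'.bound M
    exact ⟨max C C', fun z hz => hz.elim (fun hz => (hC z hz).trans (le_max_left _ _))
      fun hz => (hC' z hz).trans (le_max_right _ _)⟩
  induction k generalizing f with
  | zero => exact key h h'
  | succ k ih => exact ⟨key h h', h.2.1.union_of_isOpen h'.2.1 hS hT, ih h.2.2 h'.2.2⟩

theorem add (hS : IsOpen S) (hf : RapidDecay S k f) (hg : RapidDecay S k g) :
    RapidDecay S k (fun z => f z + g z) := by
  have key : ∀ {k : ℕ} {f g : ℂ → ℂ}, RapidDecay S k f → RapidDecay S k g →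
      ∀ M : ℕ, ∃ C : ℝ, ∀ z ∈ S, ‖f z + g z‖ * (1 + ‖z‖) ^ M ≤ C := by
    intro k f g h h' M
    obtain ⟨C, hC⟩ := h.bound M
    obtain ⟨C', hC'⟩ := h'.bound M
    refine ⟨C + C', fun z hz => ?_⟩
    grw [norm_add_le, add_mul, hC z hz, hC' z hz]
  induction k generalizing f g with
  | zero => exact key hf hg
  | succ k ih =>
    refine ⟨key hf hg, hf.2.1.add hg.2.1, (ih hf.2.2 hg.2.2).congr hS fun z hz => ?_⟩
    exact (deriv_fun_add (hf.2.1.differentiableAt (hS.mem_nhds hz))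
      (hg.2.1.differentiableAt (hS.mem_nhds hz))).symm

theorem const_mul (hS : IsOpen S) (c : ℂ) (hf : RapidDecay S k f) :
    RapidDecay S k (fun z => c * f z) := by
  have key : ∀ {k : ℕ} {f : ℂ → ℂ}, RapidDecay S k f →
      ∀ M : ℕ, ∃ C : ℝ, ∀ z ∈ S, ‖c * f z‖ * (1 + ‖z‖) ^ M ≤ C := by
    intro k f h M
    obtain ⟨C, hC⟩ := h.bound M
    refine ⟨‖c‖ * C, fun z hz => ?_⟩
    rw [norm_mul, mul_assoc]
    exact mul_le_mul_of_nonneg_left (hC z hz) (norm_nonneg c)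
  induction k generalizing f with
  | zero => exact key hf
  | succ k ih =>
    refine ⟨key hf, hf.2.1.const_mul c, (ih hf.2.2).congr hS fun z hz => ?_⟩
    exact (deriv_const_mul c (hf.2.1.differentiableAt (hS.mem_nhds hz))).symm

theorem inv_mul (hS : IsOpen S) {δ : ℝ} (hδ : 0 < δ) (hδS : ∀ z ∈ S, δ ≤ ‖z‖)
    (hf : RapidDecay S k f) : RapidDecay S k (fun z => z⁻¹ * f z) := by
  have key : ∀ {k : ℕ} {f : ℂ → ℂ}, RapidDecay S k f →
      ∀ M : ℕ, ∃ C : ℝ, ∀ z ∈ S, ‖z⁻¹ * f z‖ * (1 + ‖z‖) ^ M ≤ C := by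
    intro k f h M
    obtain ⟨C, hC⟩ := h.bound M
    refine ⟨δ⁻¹ * C, fun z hz => ?_⟩
    rw [norm_mul, mul_assoc, norm_inv]
    exact mul_le_mul (inv_anti₀ hδ (hδS z hz)) (hC z hz) (by positivity) (by positivity)
  induction k generalizing f with
  | zero => exact key hf
  | succ k ih =>
    have hne : ∀ z ∈ S, z ≠ 0 := fun z hz => norm_pos_iff.1 (hδ.trans_le (hδS z hz))
    refine ⟨key hf, (differentiableOn_inv.mono hne).mul hf.2.1, ?_⟩
    refine ((ih hf.2.2).add hS ((ih (ih hf.of_succ)).const_mul hS (-1))).congr hS fun z hz => ?_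
    have h1 := (hasDerivAt_inv (hne z hz)).mul
      (hf.2.1.differentiableAt (hS.mem_nhds hz)).hasDerivAt
    refine Eq.trans ?_ h1.deriv.symm
    have := hne z hz
    field_simp
    ring

/-- A function holomorphic near a compact set has all its derivatives bounded there, and rapid
decrease is no condition on a bounded set. -/
theorem of_isCompact {U K : Set ℂ} (hU : IsOpen U) (hK : IsCompact K) (hKU : K ⊆ U)
    (hf : DifferentiableOn ℂ f U) : RapidDecay K k f := by
  have key : ∀ {f : ℂ → ℂ}, DifferentiableOn ℂ f U →
      ∀ M : ℕ, ∃ C : ℝ, ∀ z ∈ K, ‖f z‖ * (1 + ‖z‖) ^ M ≤ C := by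
    intro f hf M
    have hc : ContinuousOn (fun z => ‖f z‖ * (1 + ‖z‖) ^ M) K :=
      (hf.continuousOn.mono hKU).norm.mul (by fun_prop)
    obtain ⟨C, hC⟩ := hK.bddAbove_image hc
    exact ⟨C, fun z hz => hC (mem_image_of_mem _ hz)⟩
  induction k generalizing f with
  | zero => exact key hf
  | succ k ih => exact ⟨key hf, hf.mono hKU, ih (hf.deriv hU)⟩

end RapidDecay

/-! ### Even functions on a strip as functions of the square -/

/-- The image `{λ² : |Im λ| < W}` of the strip under squaring, the inside of a parabola. -/
def parabolicRegion (W : ℝ) : Set ℂ :=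
  {w | ‖w‖ - w.re < 2 * W ^ 2}

/-- The function `ψ` with `φ(λ) = ψ(λ²)`, for an even function `φ` on a strip. -/
noncomputable def compSqrt (φ : ℂ → ℂ) (w : ℂ) : ℂ :=
  φ (w ^ ((2 : ℂ)⁻¹))

theorem isOpen_strip (W : ℝ) : IsOpen (strip W) :=
  isOpen_lt (Complex.continuous_im.abs) continuous_const

theorem isOpen_parabolicRegion (W : ℝ) : IsOpen (parabolicRegion W) :=
  isOpen_lt (continuous_norm.sub Complex.continuous_re) continuous_const

theorem norm_sq_sub_re_sq (z : ℂ) : ‖z ^ 2‖ - (z ^ 2).re = 2 * z.im ^ 2 := by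
  rw [norm_pow, ← Complex.normSq_eq_norm_sq, Complex.normSq_apply, pow_two z, Complex.mul_re]
  ring

theorem sq_mem_parabolicRegion_iff {W : ℝ} (hW : 0 < W) {z : ℂ} :
    z ^ 2 ∈ parabolicRegion W ↔ z ∈ strip W := by
  rw [parabolicRegion, mem_ofPred_eq, norm_sq_sub_re_sq, strip, mem_ofPred_eq,
    mul_lt_mul_iff_of_pos_left two_pos, sq_lt_sq, abs_of_pos hW]

theorem sqrt_sq (w : ℂ) : (w ^ ((2 : ℂ)⁻¹)) ^ 2 = w := by
  simp [← Complex.cpow_nat_mul]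

theorem compSqrt_sq {W : ℝ} {φ : ℂ → ℂ} (he : ∀ z ∈ strip W, φ (-z) = φ z) {z : ℂ}
    (hz : z ∈ strip W) : compSqrt φ (z ^ 2) = φ z := by
  unfold compSqrt
  rcases sq_eq_sq_iff_eq_or_eq_neg.1 (sqrt_sq (z ^ 2)) with h | h <;> rw [h]
  exact he z hz

theorem differentiableOn_compSqrt {W : ℝ} (hW : 0 < W) {φ : ℂ → ℂ}
    (hφ : DifferentiableOn ℂ φ (strip W)) (he : ∀ z ∈ strip W, φ (-z) = φ z) :
    DifferentiableOn ℂ (compSqrt φ) (parabolicRegion W) := by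
  have hO := isOpen_parabolicRegion W
  -- a holomorphic branch of the square root exists near every `w ≠ 0`; its sign is immaterial
  have branch : ∀ (r : ℂ → ℂ) (w : ℂ), (∀ v, r v ^ 2 = v) → DifferentiableAt ℂ r w →
      w ∈ parabolicRegion W → DifferentiableAt ℂ (compSqrt φ) w := by
    intro r w hr hd hw
    have hmem : ∀ v ∈ parabolicRegion W, r v ∈ strip W := fun v hv => by
      rwa [← sq_mem_parabolicRegion_iff hW, hr]
    have h1 : DifferentiableAt ℂ (fun v => φ (r v)) w :=
      (hφ.differentiableAt ((isOpen_strip W).mem_nhds (hmem w hw))).comp w hd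
    refine h1.congr_of_eventuallyEq ?_
    filter_upwards [hO.mem_nhds hw] with v hv
    rw [← compSqrt_sq he (hmem v hv), hr]
  have hne : ∀ w ∈ parabolicRegion W, w ≠ 0 → DifferentiableAt ℂ (compSqrt φ) w := by
    intro w hw h0
    by_cases hs : w ∈ Complex.slitPlane
    · refine branch (fun v => v ^ ((2 : ℂ)⁻¹)) w sqrt_sq ?_ hw
      exact differentiableAt_id.cpow_const hs
    · have hs' : -w ∈ Complex.slitPlane := by
        rw [Complex.mem_slitPlane_iff] at hs ⊢
        push Not at hs
        left
        rcases hs.1.lt_or_eq with h | h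
        · simpa using h
        · exact absurd (Complex.ext h hs.2) h0
      refine branch (fun v => Complex.I * (-v) ^ ((2 : ℂ)⁻¹)) w (fun v => ?_) ?_ hw
      · rw [mul_pow, sqrt_sq, Complex.I_sq]; ring
      · exact (differentiableAt_id.neg.cpow_const hs').const_mul _
  intro w hw
  by_cases h0 : w = 0
  · subst h0
    have han : AnalyticAt ℂ (compSqrt φ) 0 := by
      refine Complex.analyticAt_of_differentiable_on_punctured_nhds_of_continuousAt ?_ ?_
      · filter_upwards [mem_nhdsWithin_of_mem_nhds (hO.mem_nhds hw), self_mem_nhdsWithin]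
          with v hv hv0
        exact hne v hv hv0
      · have h1 : ContinuousAt (fun v : ℂ => v ^ ((2 : ℂ)⁻¹)) 0 := by
          have h2 := Complex.continuousAt_cpow_zero_of_re_pos (z := (2 : ℂ)⁻¹) (by norm_num)
          exact ContinuousAt.comp (f := fun v : ℂ => (v, (2 : ℂ)⁻¹)) h2 (by fun_prop)
        refine ContinuousAt.comp (g := φ) ?_ h1
        refine (hφ.differentiableAt ((isOpen_strip W).mem_nhds ?_)).continuousAt
        rw [← sq_mem_parabolicRegion_iff hW, sqrt_sq]
        exact hw
    exact han.differentiableAt.differentiableWithinAt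
  · exact (hne w hw h0).differentiableWithinAt

/-- The derivatives of a symbol of order `-∞` decrease rapidly on the whole strip. -/
theorem IsSymbolNegInfty.rapidDecay {W : ℝ} {φ : ℂ → ℂ} (hφ : IsSymbolNegInfty W φ) (k : ℕ) :
    RapidDecay (strip W) k φ := by
  have key : ∀ j M : ℕ, ∃ C : ℝ, ∀ z ∈ strip W, ‖iteratedDeriv j φ z‖ * (1 + ‖z‖) ^ M ≤ C := by
    intro j M
    obtain ⟨C, hC⟩ := (hφ (j - 2 * M)).bound j
    refine ⟨C * 2 ^ M, fun z hz => ?_⟩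
    have h1 := hC z hz
    have hX : (1 + ‖z‖ ^ 2) ^ (((j : ℝ) - 2 * M - j) / 2) = ((1 + ‖z‖ ^ 2) ^ M)⁻¹ := by
      rw [show ((j : ℝ) - 2 * M - j) / 2 = -(M : ℝ) by ring, Real.rpow_neg (by positivity),
        Real.rpow_natCast]
    rw [hX] at h1
    have hp : 0 < (1 + ‖z‖ ^ 2) ^ M := by positivity
    have hC0 : 0 ≤ C := by
      by_contra! h
      have : C * ((1 + ‖z‖ ^ 2) ^ M)⁻¹ < 0 := mul_neg_of_neg_of_pos h (by positivity)
      linarith [norm_nonneg (iteratedDeriv j φ z)]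
    have h2 : (1 + ‖z‖) ^ M ≤ 2 ^ M * (1 + ‖z‖ ^ 2) ^ M := by
      rw [← mul_pow]
      exact pow_le_pow_left₀ (by positivity) (by nlinarith [sq_nonneg (‖z‖ - 1)]) M
    calc _ ≤ C * ((1 + ‖z‖ ^ 2) ^ M)⁻¹ * (2 ^ M * (1 + ‖z‖ ^ 2) ^ M) :=
          mul_le_mul h1 h2 (by positivity) (by positivity)
      _ = C * 2 ^ M := by field_simp
  have hd : ∀ j : ℕ, DifferentiableOn ℂ (iteratedDeriv j φ) (strip W) := by
    intro j
    induction j with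
    | zero => simpa using (hφ 0).holomorphic
    | succ j ih => rw [iteratedDeriv_succ]; exact ih.deriv (isOpen_strip W)
  suffices ∀ j, RapidDecay (strip W) k (iteratedDeriv j φ) by simpa using this 0
  induction k with
  | zero => exact key
  | succ k ih =>
    exact fun j => ⟨key j, hd j, by simpa only [iteratedDeriv_succ] using ih (j + 1)⟩

/-- Away from the branch point, `ψ'(λ²) = (ψ ∘ sq)'(λ) / (2λ)` carries the decrease of the
derivatives from the variable `λ` to the variable `w = λ²`. -/
theorem RapidDecay.of_comp_sq {S T : Set ℂ} (hS : IsOpen S) (hT : IsOpen T) {δ : ℝ} (hδ : 0 < δ)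
    (hδS : ∀ z ∈ S, δ ≤ ‖z‖) (hST : ∀ w ∈ T, ∃ z ∈ S, z ^ 2 = w) (hST' : ∀ z ∈ S, z ^ 2 ∈ T)
    {ψ : ℂ → ℂ} (hψ : DifferentiableOn ℂ ψ T) {k : ℕ}
    (h : RapidDecay S k (fun z => ψ (z ^ 2))) : RapidDecay T k ψ := by
  have key : ∀ {k : ℕ} {ψ : ℂ → ℂ}, RapidDecay S k (fun z => ψ (z ^ 2)) →
      ∀ M : ℕ, ∃ C : ℝ, ∀ w ∈ T, ‖ψ w‖ * (1 + ‖w‖) ^ M ≤ C := by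
    intro k ψ h M
    obtain ⟨C, hC⟩ := h.bound (2 * M)
    refine ⟨C, fun w hw => ?_⟩
    obtain ⟨z, hz, rfl⟩ := hST w hw
    refine le_trans ?_ (hC z hz)
    rw [pow_mul, norm_pow]
    gcongr
    nlinarith [norm_nonneg z]
  induction k generalizing ψ with
  | zero => exact key h
  | succ k ih =>
    refine ⟨key h, hψ, ih (hψ.deriv hT) ?_⟩
    refine ((h.2.2.inv_mul hS hδ hδS).const_mul hS 2⁻¹).congr hS fun z hz => ?_
    have hz0 : z ≠ 0 := norm_pos_iff.1 (hδ.trans_le (hδS z hz))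
    have h1 : HasDerivAt (fun z => ψ (z ^ 2)) (deriv ψ (z ^ 2) * (2 * z)) z := by
      refine HasDerivAt.comp (h₂ := ψ) z
        (hψ.differentiableAt (hT.mem_nhds (hST' z hz))).hasDerivAt ?_
      simpa using hasDerivAt_pow 2 z
    rw [h1.deriv]
    field_simp

/-- If `φ(λ) = ψ(λ²)` is a symbol of order `-∞` on the strip, then all the derivatives of `ψ`
decrease rapidly on the parabolic region. -/
theorem rapidDecay_compSqrt {W : ℝ} (hW : 0 < W) {φ : ℂ → ℂ} (hφ : IsSymbolNegInfty W φ) (k : ℕ) :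
    RapidDecay (parabolicRegion W) k (compSqrt φ) := by
  have he := (hφ 0).even
  have hd := differentiableOn_compSqrt hW (hφ 0).holomorphic he
  have hO := isOpen_parabolicRegion W
  have hr : 0 < W / 2 := by positivity
  -- the branch point of `√w` is handled by compactness, as it lies in the interior of the region
  have hfar : RapidDecay (parabolicRegion W ∩ {w | (W / 2) ^ 2 < ‖w‖}) k (compSqrt φ) := by
    have hS : IsOpen (strip W ∩ {z | W / 2 < ‖z‖}) :=
      (isOpen_strip W).inter (isOpen_lt continuous_const continuous_norm)
    have hT : IsOpen (parabolicRegion W ∩ {w | (W / 2) ^ 2 < ‖w‖}) :=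
      hO.inter (isOpen_lt continuous_const continuous_norm)
    have hiff : ∀ z : ℂ, z ∈ strip W ∩ {z | W / 2 < ‖z‖} ↔
        z ^ 2 ∈ parabolicRegion W ∩ {w | (W / 2) ^ 2 < ‖w‖} := by
      intro z
      rw [mem_inter_iff, mem_inter_iff, sq_mem_parabolicRegion_iff hW, mem_ofPred_eq, mem_ofPred_eq,
        norm_pow, sq_lt_sq₀ hr.le (norm_nonneg z)]
    refine RapidDecay.of_comp_sq hS hT hr (fun z hz => hz.2.le) (fun w hw => ?_)
      (fun z hz => (hiff z).1 hz) (hd.mono inter_subset_left) ?_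
    · refine ⟨w ^ ((2 : ℂ)⁻¹), ?_, sqrt_sq w⟩
      rw [hiff, sqrt_sq]
      exact hw
    · exact ((hφ.rapidDecay k).mono inter_subset_left).congr hS
        fun z hz => (compSqrt_sq he hz.1).symm
  have hKU : Metric.closedBall (0 : ℂ) (W ^ 2 / 2) ⊆ parabolicRegion W := by
    intro w hw
    rw [mem_closedBall_zero_iff] at hw
    have := Complex.abs_re_le_norm w
    have := neg_abs_le w.re
    have : 0 < W ^ 2 := by positivity
    rw [parabolicRegion, mem_ofPred_eq]
    linarith
  have hnear : RapidDecay (Metric.ball (0 : ℂ) (W ^ 2 / 2)) k (compSqrt φ) :=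
    (RapidDecay.of_isCompact hO (isCompact_closedBall _ _) hKU hd).mono
      Metric.ball_subset_closedBall
  refine (hfar.union (hO.inter (isOpen_lt continuous_const continuous_norm)) Metric.isOpen_ball
    hnear).mono fun w hw => ?_
  by_cases h : (W / 2) ^ 2 < ‖w‖
  · exact Or.inl ⟨hw, h⟩
  · refine Or.inr (mem_ball_zero_iff.2 ?_)
    have : 0 < W ^ 2 := by positivity
    nlinarith

/-! ### Translation of an integral in a complex direction -/

section ComplexTranslation

open Filter Topology Module

variable {E : Type*} [NormedAddCommGroup E] [InnerProductSpace ℝ E] [FiniteDimensional ℝ E]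
  [MeasurableSpace E] [BorelSpace E]

/-- If translating `ξ` by `t u` amounts, for small real `t`, to moving a parameter `τ` from `0` to
`t`, and the integrand is holomorphic in `τ`, then the integral is independent of the complex
parameter `τ`, by translation invariance and the identity theorem.  This replaces a shift of
contours in one of `n` variables. -/
theorem integral_complex_translate {W : ℝ} (hW : 0 < W) {u : E} {h h' : E → ℂ → ℂ} {B : E → ℝ}
    (hB : Integrable B)
    (hm : ∀ τ : ℂ, |τ.re| < 1 → |τ.im| < W → Continuous fun ξ => h ξ τ)
    (hm' : ∀ τ : ℂ, |τ.re| < 1 → |τ.im| < W → Continuous fun ξ => h' ξ τ)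
    (hb : ∀ ξ, ∀ τ : ℂ, |τ.re| < 1 → |τ.im| < W → ‖h ξ τ‖ ≤ B ξ)
    (hb' : ∀ ξ, ∀ τ : ℂ, |τ.re| < 1 → |τ.im| < W → ‖h' ξ τ‖ ≤ B ξ)
    (hd : ∀ ξ, ∀ τ : ℂ, |τ.re| < 1 → |τ.im| < W → HasDerivAt (h ξ) (h' ξ τ) τ)
    (ht : ∀ ξ, ∀ t : ℝ, |t| < 1 → h ξ t = h (ξ + t • u) 0) :
    (∀ τ : ℂ, |τ.re| < 1 → |τ.im| < W → ∫ ξ, h ξ τ = ∫ ξ, h ξ 0) ∧ ∫ ξ, h' ξ 0 = 0 := by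
  set U : Set ℂ := {τ | |τ.re| < 1 ∧ |τ.im| < W} with hU
  have hUo : IsOpen U := (isOpen_lt Complex.continuous_re.abs continuous_const).inter
    (isOpen_lt Complex.continuous_im.abs continuous_const)
  have hUc : Convex ℝ U := by
    have h1 : U = Complex.reLm ⁻¹' Ioo (-1) 1 ∩ Complex.imLm ⁻¹' Ioo (-W) W := by
      ext τ
      simp [hU, abs_lt]
    rw [h1]
    exact ((convex_Ioo _ _).linear_preimage _).inter ((convex_Ioo _ _).linear_preimage _)
  have h0 : (0 : ℂ) ∈ U := by simp [hU, hW]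
  have key : ∀ τ ∈ U, HasDerivAt (fun τ => ∫ ξ, h ξ τ) (∫ ξ, h' ξ τ) τ := by
    intro τ hτ
    refine (hasDerivAt_integral_of_dominated_loc_of_deriv_le (F := fun τ ξ => h ξ τ)
      (F' := fun τ ξ => h' ξ τ) (bound := B) (hUo.mem_nhds hτ) ?_ ?_ ?_ ?_ hB ?_).2
    · filter_upwards [hUo.mem_nhds hτ] with σ hσ
      exact (hm σ hσ.1 hσ.2).aestronglyMeasurable
    · exact hB.mono' (hm τ hτ.1 hτ.2).aestronglyMeasurable
        (Eventually.of_forall fun ξ => hb ξ τ hτ.1 hτ.2)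
    · exact (hm' τ hτ.1 hτ.2).aestronglyMeasurable
    · exact Eventually.of_forall fun ξ σ hσ => hb' ξ σ hσ.1 hσ.2
    · exact Eventually.of_forall fun ξ σ hσ => hd ξ σ hσ.1 hσ.2
  have hA : AnalyticOnNhd ℂ (fun τ => ∫ ξ, h ξ τ) U :=
    DifferentiableOn.analyticOnNhd
      (fun τ hτ => (key τ hτ).differentiableAt.differentiableWithinAt) hUo
  have hreal : ∀ t : ℝ, |t| < 1 → ∫ ξ, h ξ t = ∫ ξ, h ξ 0 := by
    intro t h1
    simp_rw [fun ξ => ht ξ t h1]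
    exact integral_add_right_eq_self (fun ξ => h ξ 0) (t • u)
  have hfreq : ∃ᶠ z in 𝓝[≠] (0 : ℂ), ∫ ξ, h ξ z = ∫ ξ, h ξ 0 := by
    have h1 : Tendsto (fun t : ℝ => (t : ℂ)) (𝓝[≠] 0) (𝓝[≠] 0) := by
      refine tendsto_nhdsWithin_iff.2 ⟨?_, ?_⟩
      · exact (Complex.continuous_ofReal.tendsto' 0 0 rfl).mono_left nhdsWithin_le_nhds
      · filter_upwards [self_mem_nhdsWithin] with t h2
        simpa using h2
    refine h1.frequently (Eventually.frequently ?_)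
    have h2 : {t : ℝ | |t| < 1} ∈ 𝓝 0 :=
      (isOpen_lt continuous_abs continuous_const).mem_nhds (by simp)
    filter_upwards [mem_nhdsWithin_of_mem_nhds h2] with t h3
    exact hreal t h3
  have hconst : EqOn (fun τ => ∫ ξ, h ξ τ) (fun _ => ∫ ξ, h ξ 0) U :=
    hA.eqOn_of_preconnected_of_frequently_eq analyticOnNhd_const hUc.isPreconnected h0 hfreq
  refine ⟨fun τ h1 h2 => hconst ⟨h1, h2⟩, ?_⟩
  have h1 : HasDerivAt (fun τ => ∫ ξ, h ξ τ) 0 0 :=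
    (hasDerivAt_const (0 : ℂ) (∫ ξ, h ξ 0)).congr_of_eventuallyEq
      (hconst.eventuallyEq_of_mem (hUo.mem_nhds h0))
  exact (key 0 h0).unique h1

end ComplexTranslation

/-! ### Oscillatory integrals with exponential decay -/

section Oscillatory

open Filter Topology Module

variable {W : ℝ} {ψ : ℂ → ℂ}

/-- The restriction of `(ζ · u) ^ a ψ(ζ · ζ) exp(i r ζ · u)` to a complex line in the direction of
the unit vector `u`, as a function of `σ = ζ · u`.  On that line `ζ · ζ = D + σ²` for a constant
`D ≥ 0`. -/
noncomputable def oscLine (a : ℕ) (ψ : ℂ → ℂ) (r D : ℝ) (σ : ℂ) : ℂ :=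
  σ ^ a * ψ (D + σ ^ 2) * Complex.exp (Complex.I * r * σ)

theorem add_sq_mem_parabolicRegion (hW : 0 < W) {D : ℝ} (hD : 0 ≤ D) {σ : ℂ} (hσ : σ ∈ strip W) :
    (D : ℂ) + σ ^ 2 ∈ parabolicRegion W := by
  have h1 := (sq_mem_parabolicRegion_iff hW).2 hσ
  rw [parabolicRegion, mem_ofPred_eq] at h1 ⊢
  have h2 := norm_add_le (D : ℂ) (σ ^ 2)
  rw [Complex.norm_of_nonneg hD] at h2
  rw [Complex.add_re, Complex.ofReal_re]
  linarith

theorem norm_oscLine_le (hW : 0 < W) (hψ : RapidDecay (parabolicRegion W) 0 ψ) (a M : ℕ) :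
    ∃ C : ℝ, 0 ≤ C ∧ ∀ r D : ℝ, 0 ≤ D → ∀ σ ∈ strip W,
      ‖oscLine a ψ r D σ‖ ≤ C * ((1 + (D + σ.re ^ 2)) ^ M)⁻¹ * Real.exp (-(r * σ.im)) := by
  obtain ⟨C, hC⟩ := hψ (M + a)
  set K : ℝ := 1 + 2 * W ^ 2 with hK
  have hK1 : 1 ≤ K := by rw [hK]; nlinarith [sq_nonneg W]
  refine ⟨K ^ M * K ^ a * max C 0, by positivity, fun r D hD σ hσ => ?_⟩
  have hmem := add_sq_mem_parabolicRegion hW hD hσ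
  set w : ℂ := (D : ℂ) + σ ^ 2 with hw
  have him : σ.im ^ 2 ≤ W ^ 2 := sq_le_sq.2 (by
    rw [abs_of_pos hW]; exact (show |σ.im| < W from hσ).le)
  have hre : D + σ.re ^ 2 - σ.im ^ 2 ≤ ‖w‖ := by
    refine le_trans (le_of_eq ?_) (Complex.re_le_norm w)
    rw [hw, Complex.add_re, Complex.ofReal_re, pow_two σ, Complex.mul_re]
    ring
  have hn : ‖σ‖ ^ 2 = σ.re ^ 2 + σ.im ^ 2 := by
    rw [← Complex.normSq_eq_norm_sq, Complex.normSq_apply]; ring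
  have hw0 := norm_nonneg w
  have h1 : 1 + (D + σ.re ^ 2) ≤ K * (1 + ‖w‖) := by
    rw [hK]; nlinarith [mul_nonneg (sq_nonneg W) hw0]
  have h2 : ‖σ‖ ≤ K * (1 + ‖w‖) := by
    rw [hK]; nlinarith [mul_nonneg (sq_nonneg W) hw0, sq_nonneg (‖σ‖ - 1), sq_nonneg ‖σ‖]
  have hexp : ‖Complex.exp (Complex.I * r * σ)‖ = Real.exp (-(r * σ.im)) := by
    rw [Complex.norm_exp]
    congr 1
    simp
  have hpos : 0 < 1 + (D + σ.re ^ 2) := by positivity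
  rw [oscLine, norm_mul, hexp, norm_mul, norm_pow, ← div_eq_mul_inv, ← hw]
  gcongr
  rw [le_div_iff₀ (by positivity)]
  calc ‖σ‖ ^ a * ‖ψ w‖ * (1 + (D + σ.re ^ 2)) ^ M
      ≤ (K * (1 + ‖w‖)) ^ a * ‖ψ w‖ * (K * (1 + ‖w‖)) ^ M := by gcongr
    _ = K ^ M * K ^ a * (‖ψ w‖ * (1 + ‖w‖) ^ (M + a)) := by rw [mul_pow, mul_pow]; ring
    _ ≤ K ^ M * K ^ a * max C 0 := by gcongr; exact (hC w hmem).trans (le_max_left _ _)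

theorem hasDerivAt_oscLine (hW : 0 < W) (hψ : DifferentiableOn ℂ ψ (parabolicRegion W)) (a : ℕ)
    (r : ℝ) {D : ℝ} (hD : 0 ≤ D) {σ : ℂ} (hσ : σ ∈ strip W) :
    HasDerivAt (oscLine a ψ r D) (a * oscLine (a - 1) ψ r D σ + 2 * oscLine (a + 1) (deriv ψ) r D σ
      + Complex.I * r * oscLine a ψ r D σ) σ := by
  have hmem := add_sq_mem_parabolicRegion hW hD hσ
  have h1 : HasDerivAt (fun σ => ψ ((D : ℂ) + σ ^ 2)) (deriv ψ (D + σ ^ 2) * (2 * σ)) σ := by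
    refine HasDerivAt.comp (h₂ := ψ) σ
      (hψ.differentiableAt ((isOpen_parabolicRegion W).mem_nhds hmem)).hasDerivAt ?_
    simpa using (hasDerivAt_pow 2 σ).const_add (D : ℂ)
  have h2 : HasDerivAt (fun σ => Complex.exp (Complex.I * r * σ))
      (Complex.exp (Complex.I * r * σ) * (Complex.I * r)) σ := by
    simpa using ((hasDerivAt_id σ).const_mul (Complex.I * r)).cexp
  refine (((hasDerivAt_pow a σ).mul h1).mul h2).congr_deriv ?_
  simp only [oscLine, Pi.mul_apply]
  ring

variable {E : Type*} [NormedAddCommGroup E] [InnerProductSpace ℝ E]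

theorem norm_sq_sub_inner_sq_nonneg {u : E} (hu : ‖u‖ = 1) (ξ : E) :
    0 ≤ ‖ξ‖ ^ 2 - inner ℝ ξ u ^ 2 := by
  have h := abs_real_inner_le_norm ξ u
  rw [hu, mul_one] at h
  have := sq_le_sq' (by linarith [neg_abs_le (inner ℝ ξ u)]) ((le_abs_self _).trans h)
  linarith

theorem continuous_oscLine (hW : 0 < W) (hψ : ContinuousOn ψ (parabolicRegion W)) (a : ℕ) (r : ℝ)
    {u : E} (hu : ‖u‖ = 1) {τ : ℂ} (hτ : τ ∈ strip W) :
    Continuous fun ξ : E =>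
      oscLine a ψ r (‖ξ‖ ^ 2 - inner ℝ ξ u ^ 2) ((inner ℝ ξ u : ℝ) + τ) := by
  unfold oscLine
  refine Continuous.mul (Continuous.mul (by fun_prop) ?_) (by fun_prop)
  refine hψ.comp_continuous (by fun_prop) fun ξ => ?_
  refine add_sq_mem_parabolicRegion hW (norm_sq_sub_inner_sq_nonneg hu ξ) ?_
  simpa [strip] using hτ

variable [FiniteDimensional ℝ E] [MeasurableSpace E] [BorelSpace E]

/-- The integral of `(ξ · u) ^ a ψ(|ξ|²) exp(i r ξ · u)` over `ξ`. -/
noncomputable def oscIntegral (a : ℕ) (ψ : ℂ → ℂ) (r : ℝ) (u : E) : ℂ :=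
  ∫ ξ : E, oscLine a ψ r (‖ξ‖ ^ 2 - inner ℝ ξ u ^ 2) (inner ℝ ξ u : ℝ)

theorem integrable_inv_one_add_norm_sq_pow :
    Integrable fun ξ : E => ((1 + ‖ξ‖ ^ 2) ^ (finrank ℝ E + 1))⁻¹ := by
  have h := integrable_rpow_neg_one_add_norm_sq (E := E) (μ := volume)
    (r := 2 * ((finrank ℝ E + 1 : ℕ) : ℝ))
    (by push_cast; linarith [(finrank ℝ E).cast_nonneg (α := ℝ)])
  refine h.congr (Eventually.of_forall fun ξ => ?_)
  simp only
  rw [neg_div, mul_div_cancel_left₀ _ two_ne_zero, Real.rpow_neg (by positivity), Real.rpow_natCast]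

theorem integrable_oscLine (hW : 0 < W) (hψ : RapidDecay (parabolicRegion W) 1 ψ) (a : ℕ) (r : ℝ)
    {u : E} (hu : ‖u‖ = 1) :
    Integrable fun ξ : E =>
      oscLine a ψ r (‖ξ‖ ^ 2 - inner ℝ ξ u ^ 2) (inner ℝ ξ u : ℝ) := by
  obtain ⟨C, hC0, hC⟩ := norm_oscLine_le hW hψ.of_succ a (finrank ℝ E + 1)
  have h0 : (0 : ℂ) ∈ strip W := by simp [strip, hW]
  refine (integrable_inv_one_add_norm_sq_pow.const_mul C).mono' ?_
    (Eventually.of_forall fun ξ => ?_)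
  · simpa using (continuous_oscLine hW hψ.2.1.continuousOn a r hu h0).aestronglyMeasurable
  · have h1 := hC r _ (norm_sq_sub_inner_sq_nonneg hu ξ) (inner ℝ ξ u : ℝ) (by simp [strip, hW])
    simpa using h1

/-- Both the exponential decay and the integration by parts come from the translation
`ξ ↦ ξ + τ u` with complex `τ`. -/
theorem oscIntegral_translate (hW : 0 < W) (hψ : RapidDecay (parabolicRegion W) 2 ψ) (a : ℕ)
    {r : ℝ} (hr : 0 ≤ r) {u : E} (hu : ‖u‖ = 1) :
    (∀ η : ℝ, |η| < W → oscIntegral a ψ r u =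
      ∫ ξ : E, oscLine a ψ r (‖ξ‖ ^ 2 - inner ℝ ξ u ^ 2) ((inner ℝ ξ u : ℝ) + Complex.I * η)) ∧
    a * oscIntegral (a - 1) ψ r u + 2 * oscIntegral (a + 1) (deriv ψ) r u
      + Complex.I * r * oscIntegral a ψ r u = 0 := by
  have h1 : RapidDecay (parabolicRegion W) 1 ψ := hψ.of_succ
  have h1' : RapidDecay (parabolicRegion W) 1 (deriv ψ) := hψ.2.2
  have hD := norm_sq_sub_inner_sq_nonneg hu
  set M := finrank ℝ E + 1 with hM
  -- one integrable majorant for all the terms, on the rectangle `|Re τ| < 1`, `|Im τ| < W`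
  have hbd : ∀ (b : ℕ) (χ : ℂ → ℂ), RapidDecay (parabolicRegion W) 0 χ → ∃ C : ℝ, 0 ≤ C ∧
      ∀ (ξ : E) (τ : ℂ), |τ.re| < 1 → |τ.im| < W →
        ‖oscLine b χ r (‖ξ‖ ^ 2 - inner ℝ ξ u ^ 2) ((inner ℝ ξ u : ℝ) + τ)‖
          ≤ C * ((1 + ‖ξ‖ ^ 2) ^ M)⁻¹ := by
    intro b χ hχ
    obtain ⟨C, hC0, hC⟩ := norm_oscLine_le hW hχ b M
    refine ⟨C * 3 ^ M * Real.exp (r * W), by positivity, fun ξ τ hτ hτ' => ?_⟩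
    refine (hC r _ (hD ξ) _ (by simpa [strip] using hτ')).trans ?_
    simp only [Complex.add_re, Complex.ofReal_re, Complex.add_im, Complex.ofReal_im, zero_add]
    set s : ℝ := inner ℝ ξ u with hs
    have h2 : 1 + ‖ξ‖ ^ 2 ≤ 3 * (1 + (‖ξ‖ ^ 2 - s ^ 2 + (s + τ.re) ^ 2)) := by
      have h3 : τ.re ^ 2 < 1 := by
        have := (sq_lt_sq₀ (abs_nonneg _) zero_le_one).2 hτ
        rwa [sq_abs, one_pow] at this
      have h4 := hD ξ
      rw [← hs] at h4
      nlinarith [sq_nonneg (s + 2 * τ.re)]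
    have h3 : ((1 + (‖ξ‖ ^ 2 - s ^ 2 + (s + τ.re) ^ 2)) ^ M)⁻¹ ≤
        3 ^ M * ((1 + ‖ξ‖ ^ 2) ^ M)⁻¹ := by
      have h5 : 0 < 1 + ‖ξ‖ ^ 2 := by positivity
      have h6 : 0 < 1 + (‖ξ‖ ^ 2 - s ^ 2 + (s + τ.re) ^ 2) := by linarith
      rw [← div_eq_mul_inv, inv_eq_one_div, div_le_div_iff₀ (by positivity) (by positivity),
        one_mul, ← mul_pow]
      exact pow_le_pow_left₀ h5.le h2 M
    have h4 : Real.exp (-(r * τ.im)) ≤ Real.exp (r * W) := by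
      apply Real.exp_le_exp.2
      nlinarith [neg_abs_le τ.im]
    calc _ ≤ C * (3 ^ M * ((1 + ‖ξ‖ ^ 2) ^ M)⁻¹) * Real.exp (r * W) := by gcongr
      _ = _ := by ring
  obtain ⟨C₁, hC₁0, hC₁⟩ := hbd a ψ h1.of_succ
  obtain ⟨C₂, hC₂0, hC₂⟩ := hbd (a - 1) ψ h1.of_succ
  obtain ⟨C₃, hC₃0, hC₃⟩ := hbd (a + 1) (deriv ψ) h1'.of_succ
  have hr' : ‖Complex.I * (r : ℂ)‖ = r := by simp [abs_of_nonneg hr]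
  have hc1 := h1.2.1.continuousOn
  have hc1' := h1'.2.1.continuousOn
  -- `(ξ + t u) · u = ξ · u + t`, while `|ξ|² - (ξ · u)²` is unchanged by the translation
  obtain ⟨k1, k2⟩ := integral_complex_translate (E := E) hW (u := u)
    (h := fun ξ τ => oscLine a ψ r (‖ξ‖ ^ 2 - inner ℝ ξ u ^ 2) ((inner ℝ ξ u : ℝ) + τ))
    (h' := fun ξ τ =>
      a * oscLine (a - 1) ψ r (‖ξ‖ ^ 2 - inner ℝ ξ u ^ 2) ((inner ℝ ξ u : ℝ) + τ) +
      2 * oscLine (a + 1) (deriv ψ) r (‖ξ‖ ^ 2 - inner ℝ ξ u ^ 2) ((inner ℝ ξ u : ℝ) + τ) +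
      Complex.I * r * oscLine a ψ r (‖ξ‖ ^ 2 - inner ℝ ξ u ^ 2) ((inner ℝ ξ u : ℝ) + τ))
    (B := fun ξ => (C₁ + a * C₂ + 2 * C₃ + r * C₁) * ((1 + ‖ξ‖ ^ 2) ^ M)⁻¹)
    (integrable_inv_one_add_norm_sq_pow.const_mul _)
    (fun τ _ hτ => continuous_oscLine hW hc1 a r hu hτ)
    (fun τ _ hτ => ((continuous_const.mul (continuous_oscLine hW hc1 _ r hu hτ)).add
      (continuous_const.mul (continuous_oscLine hW hc1' _ r hu hτ))).add
      (continuous_const.mul (continuous_oscLine hW hc1 _ r hu hτ)))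
    (fun ξ τ hτ hτ' => by
      refine (hC₁ ξ τ hτ hτ').trans ?_
      gcongr
      nlinarith [mul_nonneg (a.cast_nonneg (α := ℝ)) hC₂0, mul_nonneg hr hC₁0])
    (fun ξ τ hτ hτ' => by
      refine (norm_add_le _ _).trans ((add_le_add_left (norm_add_le _ _) _).trans ?_)
      rw [norm_mul, norm_mul, norm_mul, hr', Complex.norm_natCast, Complex.norm_ofNat]
      grw [hC₁ ξ τ hτ hτ', hC₂ ξ τ hτ hτ', hC₃ ξ τ hτ hτ']
      have : 0 ≤ C₁ * ((1 + ‖ξ‖ ^ 2) ^ M)⁻¹ := by positivity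
      linarith)
    (fun ξ τ _ hτ => (hasDerivAt_oscLine hW h1.2.1 a r (hD ξ)
      (show _ ∈ strip W by simpa [strip] using hτ)).comp_const_add _ τ)
    (fun ξ t _ => by
      have e1 : inner ℝ (ξ + t • u) u = inner ℝ ξ u + t := by
        rw [inner_add_left, real_inner_smul_left, real_inner_self_eq_norm_sq, hu]; ring
      have e2 : ‖ξ + t • u‖ ^ 2 = ‖ξ‖ ^ 2 + 2 * t * inner ℝ ξ u + t ^ 2 := by
        rw [norm_add_sq_real, real_inner_smul_right, norm_smul, hu, mul_one, Real.norm_eq_abs,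
          sq_abs]
        ring
      simp only [e1, e2, add_zero]
      congr 1
      · ring
      · push_cast; ring)
  constructor
  · intro η hη
    have := k1 (Complex.I * η) (by simp) (by simpa using hη)
    simpa [oscIntegral] using this.symm
  · rw [integral_add, integral_add, integral_const_mul, integral_const_mul,
      integral_const_mul] at k2
    · simpa [oscIntegral] using k2
    · simpa using (integrable_oscLine hW h1 (a - 1) r hu).const_mul (a : ℂ)
    · simpa using (integrable_oscLine hW h1' (a + 1) r hu).const_mul (2 : ℂ)
    · simp only [add_zero]
      exact ((integrable_oscLine hW h1 (a - 1) r hu).const_mul (a : ℂ)).add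
        ((integrable_oscLine hW h1' (a + 1) r hu).const_mul (2 : ℂ))
    · simpa using (integrable_oscLine hW h1 a r hu).const_mul (Complex.I * r)

/-- The decay `exp(-W r)`, with the width of the strip itself in the exponent, improved by any power
of `r`: each power costs one integration by parts, which stays in the same class of integrals. -/
theorem pow_mul_norm_oscIntegral_le (hW : 0 < W)
    (hψ : ∀ k, RapidDecay (parabolicRegion W) k ψ) (a N : ℕ) :
    ∃ C : ℝ, 0 ≤ C ∧ ∀ (r : ℝ) (u : E), 0 ≤ r → ‖u‖ = 1 →
      r ^ N * ‖oscIntegral a ψ r u‖ ≤ C * Real.exp (-(W * r)) := by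
  induction N generalizing ψ a with
  | zero =>
    obtain ⟨C, hC0, hC⟩ := norm_oscLine_le hW (hψ 0) a (finrank ℝ E + 1)
    refine ⟨C * ∫ ξ : E, ((1 + ‖ξ‖ ^ 2) ^ (finrank ℝ E + 1))⁻¹,
      mul_nonneg hC0 (integral_nonneg fun ξ => by positivity), fun r u hr hu => ?_⟩
    rw [pow_zero, one_mul]
    -- the bounds on `ψ` are uniform up to the boundary, so that `η` may tend to `W`
    have hη : ∀ η ∈ Ioo 0 W, ‖oscIntegral a ψ r u‖ ≤
        C * (∫ ξ : E, ((1 + ‖ξ‖ ^ 2) ^ (finrank ℝ E + 1))⁻¹) * Real.exp (-(η * r)) := by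
      intro η hη
      have h1 : |η| < W := by rw [abs_of_pos hη.1]; exact hη.2
      rw [(oscIntegral_translate hW (hψ 2) a hr hu).1 η h1, ← integral_const_mul,
        ← integral_mul_const]
      refine norm_integral_le_of_norm_le
        ((integrable_inv_one_add_norm_sq_pow.const_mul C).mul_const _)
        (Eventually.of_forall fun ξ => ?_)
      have h2 := hC r _ (norm_sq_sub_inner_sq_nonneg hu ξ)
        ((inner ℝ ξ u : ℝ) + Complex.I * η) (by simpa [strip] using h1)
      simpa [mul_comm r η] using h2
    have hlim : Tendsto (fun η : ℝ => C * (∫ ξ : E, ((1 + ‖ξ‖ ^ 2) ^ (finrank ℝ E + 1))⁻¹) *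
        Real.exp (-(η * r))) (𝓝[<] W) (𝓝 (C * (∫ ξ : E, ((1 + ‖ξ‖ ^ 2) ^ (finrank ℝ E + 1))⁻¹) *
        Real.exp (-(W * r)))) :=
      (Continuous.tendsto (by fun_prop) W).mono_left nhdsWithin_le_nhds
    exact ge_of_tendsto hlim (mem_of_superset (Ioo_mem_nhdsLT hW) hη)
  | succ N ih =>
    obtain ⟨C₁, hC₁0, hC₁⟩ := ih hψ (a - 1)
    obtain ⟨C₂, hC₂0, hC₂⟩ := ih (fun k => (hψ (k + 1)).2.2) (a + 1)
    refine ⟨a * C₁ + 2 * C₂, by positivity, fun r u hr hu => ?_⟩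
    have h1 := (oscIntegral_translate hW (hψ 2) a hr hu).2
    have h2 : Complex.I * r * oscIntegral a ψ r u =
        -(a * oscIntegral (a - 1) ψ r u + 2 * oscIntegral (a + 1) (deriv ψ) r u) := by
      linear_combination h1
    have h3 : r * ‖oscIntegral a ψ r u‖ ≤
        a * ‖oscIntegral (a - 1) ψ r u‖ + 2 * ‖oscIntegral (a + 1) (deriv ψ) r u‖ := by
      have h4 := congrArg norm h2
      rw [norm_mul, norm_mul, Complex.norm_I, one_mul, Complex.norm_of_nonneg hr, norm_neg] at h4
      rw [h4]
      refine (norm_add_le _ _).trans (le_of_eq ?_)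
      rw [norm_mul, norm_mul, Complex.norm_natCast, Complex.norm_ofNat]
    calc r ^ (N + 1) * ‖oscIntegral a ψ r u‖ = r ^ N * (r * ‖oscIntegral a ψ r u‖) := by ring
      _ ≤ r ^ N * (a * ‖oscIntegral (a - 1) ψ r u‖ + 2 * ‖oscIntegral (a + 1) (deriv ψ) r u‖) := by
        gcongr
      _ = a * (r ^ N * ‖oscIntegral (a - 1) ψ r u‖) +
          2 * (r ^ N * ‖oscIntegral (a + 1) (deriv ψ) r u‖) := by ring
      _ ≤ a * (C₁ * Real.exp (-(W * r))) + 2 * (C₂ * Real.exp (-(W * r))) := by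
        exact add_le_add (mul_le_mul_of_nonneg_left (hC₁ r u hr hu) a.cast_nonneg)
          (mul_le_mul_of_nonneg_left (hC₂ r u hr hu) zero_le_two)
      _ = _ := by ring

end Oscillatory

/-! ### The Macdonald function and the weight -/

section Weight

theorem integrableOn_exp_mul_rpow {ν : ℝ} (hν : 0 < ν) (z : ℝ) :
    IntegrableOn (fun s => Real.exp (-(s + z ^ 2 / (4 * s))) * s ^ (ν - 1)) (Ioi 0) := by
  refine (Real.GammaIntegral_convergent hν).mono' (Measurable.aestronglyMeasurable (by fun_prop)) ?_
  refine (ae_restrict_iff' measurableSet_Ioi).2 (Filter.Eventually.of_forall fun s hs => ?_)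
  rw [mem_Ioi] at hs
  rw [Real.norm_of_nonneg (by positivity)]
  gcongr
  have : 0 ≤ z ^ 2 / (4 * s) := by positivity
  linarith

theorem image_inv_Ioi {z : ℝ} (hz : 0 < z) : (fun s : ℝ => z ^ 2 / (4 * s)) '' Ioi 0 = Ioi 0 := by
  ext t
  refine ⟨?_, fun ht => ⟨z ^ 2 / (4 * t), ?_, ?_⟩⟩
  · rintro ⟨s, hs, rfl⟩
    rw [mem_Ioi] at hs ⊢
    positivity
  · rw [mem_Ioi] at ht ⊢
    positivity
  · rw [mem_Ioi] at ht
    field_simp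

/-- The change of variables `t = z² / (4s)` in the Sommerfeld integral. -/
theorem sommerfeld_substitution {ν : ℝ} (hν : 0 < ν) {z : ℝ} (hz : 0 < z) :
    IntegrableOn (fun t => Real.exp (-(t + z ^ 2 / (4 * t))) * t ^ (-ν - 1)) (Ioi 0) ∧
    ∫ t in Ioi (0 : ℝ), Real.exp (-(t + z ^ 2 / (4 * t))) * t ^ (-ν - 1) =
      ((z / 2) ^ 2) ^ (-ν) *
        ∫ s in Ioi (0 : ℝ), Real.exp (-(s + z ^ 2 / (4 * s))) * s ^ (ν - 1) := by
  have hder : ∀ s ∈ Ioi (0 : ℝ), HasDerivWithinAt (fun s : ℝ => z ^ 2 / (4 * s))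
      (-(z ^ 2 / (4 * s ^ 2))) (Ioi 0) s := by
    intro s hs
    rw [mem_Ioi] at hs
    have h := ((hasDerivAt_inv hs.ne').const_mul (z ^ 2 / 4)).hasDerivWithinAt (s := Ioi 0)
    refine (h.congr_deriv (by field_simp)).congr_of_eventuallyEq
      (Filter.Eventually.of_forall fun x => ?_) ?_ <;> ring
  have hinj : InjOn (fun s : ℝ => z ^ 2 / (4 * s)) (Ioi 0) := by
    intro a ha b hb hab
    rw [mem_Ioi] at ha hb
    simp only at hab
    rw [div_eq_div_iff (by positivity) (by positivity)] at hab
    have := mul_left_cancel₀ (by positivity) hab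
    linarith
  have hpt : EqOn (fun s => |-(z ^ 2 / (4 * s ^ 2))| •
      (Real.exp (-(z ^ 2 / (4 * s) + z ^ 2 / (4 * (z ^ 2 / (4 * s))))) *
        (z ^ 2 / (4 * s)) ^ (-ν - 1)))
      (fun s => ((z / 2) ^ 2) ^ (-ν) * (Real.exp (-(s + z ^ 2 / (4 * s))) * s ^ (ν - 1)))
      (Ioi 0) := by
    intro s hs
    rw [mem_Ioi] at hs
    have e1 : z ^ 2 / (4 * (z ^ 2 / (4 * s))) = s := by field_simp
    have e2 : z ^ 2 / (4 * s) = (z / 2) ^ 2 * s⁻¹ := by field_simp; norm_num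
    have e3 : (z ^ 2 / (4 * s)) ^ (-ν - 1) =
        ((z / 2) ^ 2) ^ (-ν) * ((z / 2) ^ 2)⁻¹ * (s ^ (ν - 1) * s ^ 2) := by
      rw [e2, Real.mul_rpow (by positivity) (by positivity), Real.inv_rpow hs.le,
        ← Real.rpow_neg hs.le, Real.rpow_sub_one (by positivity), div_eq_mul_inv,
        ← Real.rpow_natCast s 2, ← Real.rpow_add hs]
      congr 2
      push_cast
      ring
    have e4 : |-(z ^ 2 / (4 * s ^ 2))| = (z / 2) ^ 2 * (s ^ 2)⁻¹ := by
      rw [abs_neg, abs_of_nonneg (by positivity)]; field_simp; norm_num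
    simp only [e1, e3, e4, smul_eq_mul, add_comm (z ^ 2 / (4 * s)) s]
    field_simp
  have h1 := integrableOn_image_iff_integrableOn_abs_deriv_smul measurableSet_Ioi hder hinj
    (fun t => Real.exp (-(t + z ^ 2 / (4 * t))) * t ^ (-ν - 1))
  have h2 := integral_image_eq_integral_abs_deriv_smul measurableSet_Ioi hder hinj
    (fun t => Real.exp (-(t + z ^ 2 / (4 * t))) * t ^ (-ν - 1))
  rw [image_inv_Ioi hz] at h1 h2
  refine ⟨h1.2 ?_, ?_⟩
  · refine IntegrableOn.congr_fun ?_ hpt.symm measurableSet_Ioi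
    exact (integrableOn_exp_mul_rpow hν z).const_mul _
  · rw [h2, setIntegral_congr_fun measurableSet_Ioi hpt, integral_const_mul]

theorem macdonaldKTilde_eq {ν : ℝ} (hν : 0 < ν) {z : ℝ} (hz : 0 < z) :
    macdonaldKTilde ν z =
      2 ^ ν / 2 * ∫ s in Ioi (0 : ℝ), Real.exp (-(s + z ^ 2 / (4 * s))) * s ^ (ν - 1) := by
  rw [macdonaldKTilde, macdonaldK, (sommerfeld_substitution hν hz).2]
  have h1 : z ^ ν = 2 ^ ν * (z / 2) ^ ν := by
    rw [← Real.mul_rpow two_pos.le (by positivity)]; congr 1; ring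
  have h2 : ((z / 2) ^ 2) ^ (-ν) = ((z / 2) ^ ν)⁻¹ * ((z / 2) ^ ν)⁻¹ := by
    rw [pow_two, Real.mul_rpow (by positivity) (by positivity), Real.rpow_neg (by positivity)]
  have h3 : (z / 2) ^ ν ≠ 0 := (Real.rpow_pos_of_pos (by positivity) ν).ne'
  rw [h1, h2]
  generalize ∫ s in Ioi (0 : ℝ), Real.exp (-(s + z ^ 2 / (4 * s))) * s ^ (ν - 1) = I
  field_simp

theorem macdonaldKTilde_pos {ν : ℝ} (hν : 0 < ν) {z : ℝ} (hz : 0 < z) :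
    0 < macdonaldKTilde ν z := by
  rw [macdonaldKTilde_eq hν hz]
  refine mul_pos (by positivity) ?_
  rw [setIntegral_pos_iff_support_of_nonneg_ae _ (integrableOn_exp_mul_rpow hν z)]
  · have h : Ioi (0 : ℝ) ⊆
        Function.support (fun s => Real.exp (-(s + z ^ 2 / (4 * s))) * s ^ (ν - 1)) ∩ Ioi 0 := by
      intro s hs
      refine ⟨?_, hs⟩
      rw [mem_Ioi] at hs
      exact (show 0 < Real.exp (-(s + z ^ 2 / (4 * s))) * s ^ (ν - 1) by positivity).ne'
    exact lt_of_lt_of_le (by simp) (measure_mono h)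
  · refine (ae_restrict_iff' measurableSet_Ioi).2 (Filter.Eventually.of_forall fun s hs => ?_)
    rw [mem_Ioi] at hs
    simp only [Pi.zero_apply]
    positivity

theorem macdonaldKTilde_antitoneOn {ν : ℝ} (hν : 0 < ν) :
    AntitoneOn (macdonaldKTilde ν) (Ioi 0) := by
  intro a ha b hb hab
  rw [mem_Ioi] at ha hb
  rw [macdonaldKTilde_eq hν ha, macdonaldKTilde_eq hν hb]
  refine mul_le_mul_of_nonneg_left ?_ (by positivity)
  refine setIntegral_mono_on (integrableOn_exp_mul_rpow hν b) (integrableOn_exp_mul_rpow hν a)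
    measurableSet_Ioi fun s hs => ?_
  rw [mem_Ioi] at hs
  gcongr

theorem macdonaldKTilde_le {ν : ℝ} (hν : 0 < ν) {z : ℝ} (hz : 0 < z) :
    macdonaldKTilde ν z ≤ 2 ^ ν / 2 * Real.Gamma ν := by
  rw [macdonaldKTilde_eq hν hz, Real.Gamma_eq_integral hν]
  refine mul_le_mul_of_nonneg_left ?_ (by positivity)
  refine setIntegral_mono_on (integrableOn_exp_mul_rpow hν z) (Real.GammaIntegral_convergent hν)
    measurableSet_Ioi fun s hs => ?_
  rw [mem_Ioi] at hs
  gcongr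
  have : 0 ≤ z ^ 2 / (4 * s) := by positivity
  linarith

/-- For `ν ≥ 1` the shift `s ↦ s + δ / 2` of the variable of integration costs a factor `exp(-δ)`:
this is the inequality `(z + δ)² / (s + δ / 2) ≤ z² / s + δ² / (δ / 2)`. -/
theorem macdonaldKTilde_le_exp_mul_of_one_le {ν : ℝ} (hν : 1 ≤ ν) {z δ : ℝ} (hz : 0 < z)
    (hδ : 0 ≤ δ) : macdonaldKTilde ν z ≤ Real.exp δ * macdonaldKTilde ν (z + δ) := by
  have hν0 : 0 < ν := by linarith
  have hzδ : 0 < z + δ := by linarith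
  rw [macdonaldKTilde_eq hν0 hz, macdonaldKTilde_eq hν0 hzδ, mul_left_comm]
  refine mul_le_mul_of_nonneg_left ?_ (by positivity)
  set g : ℝ → ℝ := fun s => Real.exp (-(s + (z + δ) ^ 2 / (4 * s))) * s ^ (ν - 1) with hg
  have hgi : IntegrableOn g (Ioi 0) := integrableOn_exp_mul_rpow hν0 (z + δ)
  have hsub : Ioi (δ / 2) ⊆ Ioi (0 : ℝ) := Ioi_subset_Ioi (by linarith)
  have himg : (fun s => s + δ / 2) '' Ioi 0 = Ioi (δ / 2) := by simp
  have hder : ∀ s ∈ Ioi (0 : ℝ), HasDerivWithinAt (fun s : ℝ => s + δ / 2) 1 (Ioi 0) s :=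
    fun s _ => ((hasDerivAt_id s).add_const _).hasDerivWithinAt
  have hinj : InjOn (fun s : ℝ => s + δ / 2) (Ioi 0) := (add_left_injective (δ / 2)).injOn
  have hi1 := (integrableOn_image_iff_integrableOn_abs_deriv_smul measurableSet_Ioi hder hinj g).1
    (by rw [himg]; exact hgi.mono_set hsub)
  have hi2 := integral_image_eq_integral_abs_deriv_smul measurableSet_Ioi hder hinj g
  rw [himg] at hi2
  simp only [abs_one, one_smul] at hi1 hi2
  have h1 : ∫ s in Ioi (δ / 2), g s ≤ ∫ s in Ioi 0, g s := by
    refine setIntegral_mono_set hgi ?_ (Filter.Eventually.of_forall hsub)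
    refine (ae_restrict_iff' measurableSet_Ioi).2 (Filter.Eventually.of_forall fun s hs => ?_)
    rw [mem_Ioi] at hs
    simp only [Pi.zero_apply, hg]
    positivity
  refine le_trans ?_ (mul_le_mul_of_nonneg_left h1 (Real.exp_pos δ).le)
  rw [hi2, ← integral_const_mul]
  refine setIntegral_mono_on (integrableOn_exp_mul_rpow hν0 z) (hi1.const_mul _)
    measurableSet_Ioi fun s hs => ?_
  rw [mem_Ioi] at hs
  simp only [hg]
  rw [← mul_assoc, ← Real.exp_add]
  have h2 : s ^ (ν - 1) ≤ (s + δ / 2) ^ (ν - 1) :=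
    Real.rpow_le_rpow hs.le (by linarith) (by linarith)
  refine mul_le_mul (Real.exp_le_exp.2 ?_) h2 (by positivity) (by positivity)
  have h3 : (z + δ) ^ 2 / (4 * (s + δ / 2)) ≤ z ^ 2 / (4 * s) + δ / 2 := by
    rw [div_add_div _ _ (by positivity) two_ne_zero,
      div_le_div_iff₀ (by positivity) (by positivity)]
    nlinarith [mul_nonneg hδ (sq_nonneg (z - 2 * s))]
  linarith

/-- `K̃_{1/2}(z)` is a multiple of `exp(-z)`: averaging the two forms of the Sommerfeld integral
produces the differential of `q = √s - z / (2√s)`, and `q² = s + z² / (4s) - z`. -/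
theorem macdonaldKTilde_half {z : ℝ} (hz : 0 < z) :
    macdonaldKTilde (1 / 2) z = 2 ^ (1 / 2 : ℝ) / 2 * √Real.pi * Real.exp (-z) := by
  have hhalf : (0 : ℝ) < 1 / 2 := by norm_num
  rw [macdonaldKTilde_eq hhalf hz, mul_assoc]
  congr 1
  obtain ⟨hi, he⟩ := sommerfeld_substitution hhalf hz
  have hB := integrableOn_exp_mul_rpow hhalf z
  set I := ∫ s in Ioi (0 : ℝ), Real.exp (-(s + z ^ 2 / (4 * s))) * s ^ ((1 / 2 : ℝ) - 1) with hI
  have hc : ((z / 2) ^ 2) ^ (-(1 / 2 : ℝ)) = (z / 2)⁻¹ := by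
    rw [Real.rpow_neg (by positivity), ← Real.sqrt_eq_rpow, Real.sqrt_sq (by positivity)]
  rw [hc] at he
  set q : ℝ → ℝ := fun s => √s - z / (2 * √s) with hq
  have hder : ∀ s ∈ Ioi (0 : ℝ), HasDerivWithinAt q
      (1 / (2 * √s) + z / (4 * (s * √s))) (Ioi 0) s := by
    intro s hs
    rw [mem_Ioi] at hs
    have h0 : 0 < √s := Real.sqrt_pos.2 hs
    have h1 := Real.hasDerivAt_sqrt hs.ne'
    have h2 := (h1.inv h0.ne').const_mul (z / 2)
    have h3 := (h1.sub h2).hasDerivWithinAt (s := Ioi 0)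
    refine (h3.congr_deriv ?_).congr_of_eventuallyEq (Filter.Eventually.of_forall fun x => ?_) ?_
    · rw [Real.sq_sqrt hs.le]
      field_simp
      ring
    · simp only [hq, Pi.sub_apply, Pi.inv_apply]
      ring
    · simp only [hq, Pi.sub_apply, Pi.inv_apply]
      ring
  have hinj : InjOn q (Ioi 0) := by
    have : StrictMonoOn q (Ioi 0) := by
      intro a ha b hb hab
      rw [mem_Ioi] at ha hb
      have h1 : √a < √b := Real.sqrt_lt_sqrt ha.le hab
      have h2 : 0 < √a := Real.sqrt_pos.2 ha
      have h3 : z / (2 * √b) ≤ z / (2 * √a) := by gcongr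
      simp only [hq]
      linarith
    exact this.injOn
  have himg : q '' Ioi 0 = univ := by
    refine eq_univ_of_forall fun y => ?_
    set r : ℝ := √(y ^ 2 + 2 * z) with hr
    have hr2 : r ^ 2 = y ^ 2 + 2 * z := Real.sq_sqrt (by positivity)
    have hr0 : |y| < r := by
      rw [← Real.sqrt_sq_eq_abs]
      exact Real.sqrt_lt_sqrt (sq_nonneg y) (by linarith)
    have hpos : 0 < (y + r) / 2 := by linarith [neg_abs_le y]
    refine ⟨((y + r) / 2) ^ 2, mem_Ioi.2 (by positivity), ?_⟩
    simp only [hq]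
    rw [Real.sqrt_sq hpos.le]
    have : y + r ≠ 0 := by linarith
    field_simp
    nlinarith
  have h := integral_image_eq_integral_abs_deriv_smul measurableSet_Ioi hder hinj
    (fun y => Real.exp (-1 * y ^ 2))
  rw [himg, Measure.restrict_univ, integral_gaussian, div_one] at h
  have hpt : EqOn (fun s => |1 / (2 * √s) + z / (4 * (s * √s))| • Real.exp (-1 * q s ^ 2))
      (fun s => Real.exp z * (1 / 2 * (Real.exp (-(s + z ^ 2 / (4 * s))) * s ^ ((1 / 2 : ℝ) - 1)) +
        z / 4 * (Real.exp (-(s + z ^ 2 / (4 * s))) * s ^ (-(1 / 2 : ℝ) - 1)))) (Ioi 0) := by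
    intro s hs
    rw [mem_Ioi] at hs
    have h0 : 0 < √s := Real.sqrt_pos.2 hs
    have e1 : s ^ ((1 / 2 : ℝ) - 1) = (√s)⁻¹ := by
      rw [Real.sqrt_eq_rpow, ← Real.rpow_neg hs.le]; norm_num
    have e2 : s ^ (-(1 / 2 : ℝ) - 1) = (s * √s)⁻¹ := by
      rw [Real.rpow_sub_one hs.ne', Real.sqrt_eq_rpow, Real.rpow_neg hs.le, mul_inv]
      ring
    have e3 : -1 * q s ^ 2 = z + -(s + z ^ 2 / (4 * s)) := by
      have h2 : √s ^ 2 = s := Real.sq_sqrt hs.le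
      have h3 : q s ^ 2 = √s ^ 2 - z + z ^ 2 / (4 * √s ^ 2) := by
        simp only [hq]
        field_simp
        ring
      rw [h3, h2]
      ring
    simp only [e1, e2, e3, Real.exp_add]
    rw [abs_of_nonneg (by positivity), smul_eq_mul]
    field_simp
  rw [setIntegral_congr_fun measurableSet_Ioi hpt, integral_const_mul,
    integral_add (hB.const_mul _) (hi.const_mul _), integral_const_mul, integral_const_mul, he,
    ← hI] at h
  rw [h, Real.exp_neg]
  field_simp
  ring

theorem macdonaldKTilde_le_exp_mul {n : ℕ} (hn : 1 ≤ n) {a b : ℝ} (ha : 0 < a) (hb : 0 < b) :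
    macdonaldKTilde ((n : ℝ) / 2) a ≤ Real.exp |a - b| * macdonaldKTilde ((n : ℝ) / 2) b := by
  have hν : 0 < (n : ℝ) / 2 := by positivity
  rcases le_total b a with h | h
  · have h1 := macdonaldKTilde_antitoneOn hν hb ha h
    have h2 := (macdonaldKTilde_pos hν hb).le
    have h3 := Real.one_le_exp (abs_nonneg (a - b))
    nlinarith
  · rw [abs_sub_comm, abs_of_nonneg (sub_nonneg.2 h)]
    rcases hn.eq_or_lt with rfl | hn
    · rw [Nat.cast_one, macdonaldKTilde_half ha, macdonaldKTilde_half hb, mul_left_comm,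
        ← Real.exp_add]
      refine le_of_eq ?_
      congr 2
      ring
    · have h1 : 1 ≤ (n : ℝ) / 2 := by
        rw [le_div_iff₀ two_pos]; exact_mod_cast hn
      simpa using macdonaldKTilde_le_exp_mul_of_one_le h1 ha (sub_nonneg.2 h)

variable {n : ℕ} {ρ : ℝ} {p : ℝ≥0∞}

theorem gammaExp_nonneg (p : ℝ≥0∞) : 0 ≤ gammaExp p := abs_nonneg _

theorem weight_pos (hn : 1 ≤ n) (hρ : 0 < ρ) {x : EuclideanSpace ℝ (Fin n)} (hx : x ≠ 0) :
    0 < weight n ρ p x :=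
  Real.rpow_pos_of_pos (macdonaldKTilde_pos (by positivity)
    (mul_pos hρ (norm_pos_iff.2 hx))) _

theorem weight_le_exp_mul (hn : 1 ≤ n) (hρ : 0 < ρ) {x y : EuclideanSpace ℝ (Fin n)} (hx : x ≠ 0)
    (hy : y ≠ 0) : weight n ρ p x ≤
      Real.exp (gammaExp p * ρ * ‖x - y‖) ^ p.toReal * weight n ρ p y := by
  have hx' := mul_pos hρ (norm_pos_iff.2 hx)
  have hy' := mul_pos hρ (norm_pos_iff.2 hy)
  have hν : 0 < (n : ℝ) / 2 := by positivity
  have he : 0 ≤ gammaExp p * p.toReal := mul_nonneg (gammaExp_nonneg p) ENNReal.toReal_nonneg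
  have h1 := Real.rpow_le_rpow (macdonaldKTilde_pos hν hx').le
    (macdonaldKTilde_le_exp_mul hn hx' hy') he
  rw [Real.mul_rpow (Real.exp_pos _).le (macdonaldKTilde_pos hν hy').le] at h1
  refine h1.trans (mul_le_mul_of_nonneg_right ?_ (Real.rpow_nonneg
    (macdonaldKTilde_pos hν hy').le _))
  rw [← Real.exp_mul, ← Real.exp_mul]
  apply Real.exp_le_exp.2
  rw [← mul_sub, abs_mul, abs_of_pos hρ]
  have := mul_le_mul_of_nonneg_left (abs_norm_sub_norm_le x y) (mul_nonneg he hρ.le)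
  nlinarith

theorem weight_le (hn : 1 ≤ n) (hρ : 0 < ρ) :
    ∃ C : ℝ, 0 ≤ C ∧ ∀ x : EuclideanSpace ℝ (Fin n), x ≠ 0 → weight n ρ p x ≤ C := by
  have hν : 0 < (n : ℝ) / 2 := by positivity
  have he : 0 ≤ gammaExp p * p.toReal := mul_nonneg (gammaExp_nonneg p) ENNReal.toReal_nonneg
  have hG := Real.Gamma_pos_of_pos hν
  refine ⟨(2 ^ ((n : ℝ) / 2) / 2 * Real.Gamma ((n : ℝ) / 2)) ^ (gammaExp p * p.toReal),
    by positivity, fun x hx => ?_⟩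
  have hx' := mul_pos hρ (norm_pos_iff.2 hx)
  exact Real.rpow_le_rpow (macdonaldKTilde_pos hν hx').le (macdonaldKTilde_le hν hx') he

theorem measurable_weight : Measurable (weight n ρ p) := by
  have h1 : Measurable fun z : ℝ => ∫ t in Ioi (0 : ℝ),
      Real.exp (-(t + z ^ 2 / (4 * t))) * t ^ (-((n : ℝ) / 2) - 1) := by
    refine (StronglyMeasurable.integral_prod_right (f := fun (z t : ℝ) =>
      Real.exp (-(t + z ^ 2 / (4 * t))) * t ^ (-((n : ℝ) / 2) - 1)) ?_).measurable
    exact Measurable.stronglyMeasurable (by unfold Function.uncurry; fun_prop)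
  have h2 : Measurable (macdonaldKTilde ((n : ℝ) / 2)) := by
    unfold macdonaldKTilde macdonaldK
    fun_prop
  unfold weight
  fun_prop

end Weight

/-! ### Convolution operators on weighted `L^p` spaces -/

section Convolution

/-- Jensen's inequality for the measure `κ dμ`, with its total mass not normalized. -/
theorem lintegral_mul_rpow_le {α : Type*} [MeasurableSpace α] {μ : Measure α} {κ h : α → ℝ≥0∞}
    (hκ : AEMeasurable κ μ) (hh : AEMeasurable h μ) {p : ℝ} (hp : 1 ≤ p) :
    (∫⁻ y, κ y * h y ∂μ) ^ p ≤ (∫⁻ y, κ y ∂μ) ^ (p - 1) * ∫⁻ y, κ y * h y ^ p ∂μ := by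
  have hp0 : 0 < p := by linarith
  have h1 := eLpNorm'_le_eLpNorm'_mul_rpow_measure_univ (μ := μ.withDensity κ) one_pos hp
    (hh.mono_ac (withDensity_absolutelyContinuous μ κ)).aestronglyMeasurable
  simp only [eLpNorm', enorm_eq_self, ENNReal.rpow_one, div_one,
    withDensity_apply _ MeasurableSet.univ, Measure.restrict_univ] at h1
  rw [lintegral_withDensity_eq_lintegral_mul₀ hκ hh,
    lintegral_withDensity_eq_lintegral_mul₀ hκ (hh.pow_const p)] at h1
  simp only [Pi.mul_apply] at h1
  refine (ENNReal.rpow_le_rpow h1 hp0.le).trans (le_of_eq ?_)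
  rw [ENNReal.mul_rpow_of_nonneg _ _ hp0.le, ← ENNReal.rpow_mul, ← ENNReal.rpow_mul,
    one_div_mul_cancel hp0.ne', ENNReal.rpow_one, sub_mul, one_div_mul_cancel hp0.ne', one_mul,
    mul_comm]

variable {E : Type*} [NormedAddCommGroup E] [InnerProductSpace ℝ E] [FiniteDimensional ℝ E]
  [MeasurableSpace E] [BorelSpace E]

/-- Young's inequality with a weight: a weight `w` that varies at most by the factor `θ(x - y) ^ p`
between `x` and `y` is absorbed into the kernel. -/
theorem lintegral_conv_rpow_mul_le {k : E → ℂ} (hk : Measurable k) {θ : E → ℝ≥0∞}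
    (hθ : Measurable θ) {w : E → ℝ≥0∞} (hw : Measurable w) {p : ℝ} (hp : 1 ≤ p)
    (hwθ : ∀ᵐ x : E, ∀ᵐ y : E, w x ≤ θ (x - y) ^ p * w y) {g : E → ℝ≥0∞} (hg : AEMeasurable g) :
    ∫⁻ x, w x * (∫⁻ y, ‖k (x - y)‖ₑ * g y) ^ p ≤
      (∫⁻ x, ‖k x‖ₑ * θ x) ^ p * ∫⁻ x, w x * g x ^ p := by
  have hp0 : 0 < p := by linarith
  set κ : E → ℝ≥0∞ := fun x => ‖k x‖ₑ * θ x with hκ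
  have hκm : Measurable κ := hk.enorm.mul hθ
  set A := ∫⁻ x, κ x with hA
  set H : E → ℝ≥0∞ := fun y => w y * g y ^ p with hH
  have hHm : AEMeasurable H := hw.aemeasurable.mul (hg.pow_const p)
  -- with `h = w ^ (1 / p) g` the weight drops out, and Jensen's inequality applies to `κ(x - y) dy`
  have hpt : ∀ᵐ x : E, w x * (∫⁻ y, ‖k (x - y)‖ₑ * g y) ^ p ≤
      A ^ (p - 1) * ∫⁻ y, κ (x - y) * H y := by
    filter_upwards [hwθ] with x hx
    have hκx : Measurable fun y => κ (x - y) := hκm.comp (measurable_const.sub measurable_id)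
    have h1 : w x ^ (1 / p) * ∫⁻ y, ‖k (x - y)‖ₑ * g y ≤
        ∫⁻ y, κ (x - y) * (w y ^ (1 / p) * g y) := by
      have hkx : Measurable fun y => ‖k (x - y)‖ₑ :=
        (hk.comp (measurable_const.sub measurable_id)).enorm
      rw [← lintegral_const_mul'' (f := fun y => ‖k (x - y)‖ₑ * g y) _
        (hkx.aemeasurable.mul hg)]
      refine lintegral_mono_ae ?_
      filter_upwards [hx] with y hy
      have h2 : w x ^ (1 / p) ≤ θ (x - y) * w y ^ (1 / p) := by
        refine (ENNReal.rpow_le_rpow hy (by positivity)).trans (le_of_eq ?_)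
        rw [ENNReal.mul_rpow_of_nonneg _ _ (by positivity), ← ENNReal.rpow_mul,
          mul_one_div_cancel hp0.ne', ENNReal.rpow_one]
      calc w x ^ (1 / p) * (‖k (x - y)‖ₑ * g y)
          ≤ θ (x - y) * w y ^ (1 / p) * (‖k (x - y)‖ₑ * g y) := by gcongr
        _ = κ (x - y) * (w y ^ (1 / p) * g y) := by simp only [hκ]; ring
    have h3 := (ENNReal.rpow_le_rpow h1 hp0.le).trans (lintegral_mul_rpow_le hκx.aemeasurable
      ((hw.pow_const (1 / p)).aemeasurable.mul hg) hp)
    have h4 : ∀ y, (w y ^ (1 / p) * g y) ^ p = H y := fun y => by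
      rw [ENNReal.mul_rpow_of_nonneg _ _ hp0.le, ← ENNReal.rpow_mul, one_div_mul_cancel hp0.ne',
        ENNReal.rpow_one]
    rw [ENNReal.mul_rpow_of_nonneg _ _ hp0.le, ← ENNReal.rpow_mul, one_div_mul_cancel hp0.ne',
      ENNReal.rpow_one, lintegral_sub_left_eq_self κ x] at h3
    simpa only [Pi.mul_apply, h4] using h3
  have hprod : AEMeasurable (fun z : E × E => κ (z.1 - z.2) * H z.2)
      ((volume : Measure E).prod volume) :=
    (hκm.comp (measurable_fst.sub measurable_snd)).aemeasurable.mul hHm.comp_snd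
  calc ∫⁻ x, w x * (∫⁻ y, ‖k (x - y)‖ₑ * g y) ^ p
      ≤ ∫⁻ x, A ^ (p - 1) * ∫⁻ y, κ (x - y) * H y := lintegral_mono_ae hpt
    _ = A ^ (p - 1) * ∫⁻ x, ∫⁻ y, κ (x - y) * H y :=
        lintegral_const_mul'' _ hprod.lintegral_prod_right'
    _ = A ^ (p - 1) * ∫⁻ y, ∫⁻ x, κ (x - y) * H y := by
        rw [lintegral_lintegral_swap hprod]
    _ = A ^ (p - 1) * ∫⁻ y, A * H y := by
        congr 1
        refine lintegral_congr fun y => ?_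
        rw [lintegral_mul_const (f := fun x => κ (x - y)) _
          (hκm.comp (measurable_id.sub measurable_const)),
          lintegral_sub_right_eq_self κ y]
    _ = A ^ (p - 1) * A * ∫⁻ y, H y := by rw [lintegral_const_mul'' _ hHm, mul_assoc]
    _ = A ^ p * ∫⁻ y, H y := by
        congr 1
        nth_rewrite 2 [← ENNReal.rpow_one A]
        rw [← ENNReal.rpow_add_of_nonneg _ _ (by linarith) zero_le_one, sub_add_cancel]

/-- The convolution `k * f`. -/
noncomputable def conv (k f : E → ℂ) (x : E) : ℂ :=
  ∫ y, k (x - y) * f y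

variable {k : E → ℂ} {θ w : E → ℝ≥0∞} {p : ℝ≥0∞} {f : E → ℂ}

theorem eLpNorm_conv_le (hk : Measurable k) (hθ : Measurable θ)
    (hA : ∫⁻ x, ‖k x‖ₑ * θ x ≠ ∞) (hw : Measurable w) (hw0 : ∀ᵐ x : E, w x ≠ 0)
    (hp1 : 1 ≤ p) (hp : p ≠ ∞)
    (hwθ : ∀ᵐ x : E, ∀ᵐ y : E, w x ≤ θ (x - y) ^ p.toReal * w y)
    (hf : MemLp f p (volume.withDensity w)) :
    (∀ᵐ x : E, Integrable fun y => k (x - y) * f y) ∧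
    AEStronglyMeasurable (conv k f) ∧
    eLpNorm (conv k f) p (volume.withDensity w) ≤
      (∫⁻ x, ‖k x‖ₑ * θ x) * eLpNorm f p (volume.withDensity w) := by
  have hp0 : p ≠ 0 := (zero_lt_one.trans_le hp1).ne'
  have hp1' : 1 ≤ p.toReal := by
    rw [← ENNReal.toReal_one]; exact ENNReal.toReal_mono hp hp1
  have hp0' : 0 < p.toReal := by linarith
  have hfm : AEStronglyMeasurable f :=
    hf.1.mono_ac (withDensity_absolutelyContinuous' hw.aemeasurable hw0)
  have hprod : AEStronglyMeasurable (fun z : E × E => k (z.1 - z.2) * f z.2)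
      ((volume : Measure E).prod volume) :=
    (hk.comp (measurable_fst.sub measurable_snd)).aestronglyMeasurable.mul hfm.comp_snd
  have hmain := lintegral_conv_rpow_mul_le hk hθ hw hp1' hwθ hfm.enorm
  have hfw : ∫⁻ x, w x * ‖f x‖ₑ ^ p.toReal = eLpNorm f p (volume.withDensity w) ^ p.toReal := by
    rw [eLpNorm_eq_lintegral_rpow_enorm_toReal hp0 hp,
      lintegral_withDensity_eq_lintegral_mul₀ hw.aemeasurable (hfm.enorm.pow_const _),
      ← ENNReal.rpow_mul, one_div_mul_cancel hp0'.ne', ENNReal.rpow_one]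
    rfl
  rw [hfw] at hmain
  set I : E → ℝ≥0∞ := fun x => ∫⁻ y, ‖k (x - y)‖ₑ * ‖f y‖ₑ with hI
  have hprod' : AEMeasurable (fun z : E × E => ‖k (z.1 - z.2)‖ₑ * ‖f z.2‖ₑ)
      ((volume : Measure E).prod volume) :=
    (hk.comp (measurable_fst.sub measurable_snd)).enorm.aemeasurable.mul hfm.enorm.comp_snd
  have hIm : AEMeasurable I := hprod'.lintegral_prod_right'
  have hfin : ∀ᵐ x : E, I x < ∞ := by
    have h1 : ∫⁻ x, w x * I x ^ p.toReal ≠ ∞ := by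
      refine ne_top_of_le_ne_top ?_ hmain
      exact ENNReal.mul_ne_top (ENNReal.rpow_ne_top_of_nonneg hp0'.le hA)
        (ENNReal.rpow_ne_top_of_nonneg hp0'.le hf.2.ne)
    filter_upwards [ae_lt_top' (hw.aemeasurable.mul (hIm.pow_const _)) h1, hw0] with x hx hx0
    by_contra h
    rw [not_lt, top_le_iff] at h
    rw [Pi.mul_apply, h, ENNReal.top_rpow_of_pos hp0', ENNReal.mul_top hx0] at hx
    exact lt_irrefl _ hx
  refine ⟨?_, hprod.integral_prod_right', ?_⟩
  · filter_upwards [hfin] with x hx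
    have hkx : AEStronglyMeasurable fun y => k (x - y) :=
      (hk.comp (measurable_const.sub measurable_id)).aestronglyMeasurable
    refine ⟨hkx.mul hfm, ?_⟩
    simpa only [HasFiniteIntegral, enorm_mul] using hx
  · rw [eLpNorm_eq_lintegral_rpow_enorm_toReal hp0 hp, one_div,
      ENNReal.rpow_inv_le_iff hp0', ENNReal.mul_rpow_of_nonneg _ _ hp0'.le]
    refine (lintegral_withDensity_le_lintegral_mul _ hw _).trans (le_trans ?_ hmain)
    refine lintegral_mono fun x => ?_
    simp only [Pi.mul_apply]
    gcongr
    refine (enorm_integral_le_lintegral_enorm _).trans (le_of_eq ?_)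
    simp only [enorm_mul]

/-- Convolution with `k` as a bounded operator on `L^p(w dx)`. -/
theorem exists_convolution_operator (hk : Measurable k) (hθ : Measurable θ)
    (hA : ∫⁻ x, ‖k x‖ₑ * θ x ≠ ∞) (hw : Measurable w) (hw0 : ∀ᵐ x : E, w x ≠ 0)
    [Fact (1 ≤ p)] (hp : p ≠ ∞)
    (hwθ : ∀ᵐ x : E, ∀ᵐ y : E, w x ≤ θ (x - y) ^ p.toReal * w y)
    {ν : Measure E} (hν : ν = volume.withDensity w) :
    ∃ T : Lp ℂ p ν →L[ℂ] Lp ℂ p ν, ∀ (f : E → ℂ) (hf : MemLp f p ν),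
      (T (hf.toLp f) : E → ℂ) =ᵐ[volume] conv k f := by
  subst hν
  have hp1 : 1 ≤ p := Fact.out
  set ν := volume.withDensity w with hν
  have hac : (volume : Measure E) ≪ ν := withDensity_absolutelyContinuous' hw.aemeasurable hw0
  have hca : ν ≪ volume := withDensity_absolutelyContinuous _ _
  have main : ∀ f : Lp ℂ p ν, _ := fun f =>
    eLpNorm_conv_le hk hθ hA hw hw0 hp1 hp hwθ (Lp.memLp f)
  have hmem : ∀ f : Lp ℂ p ν, MemLp (conv k f) p ν := fun f =>
    ⟨(main f).2.1.mono_ac hca,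
      (main f).2.2.trans_lt (ENNReal.mul_lt_top hA.lt_top (Lp.memLp f).2)⟩
  let T₀ : Lp ℂ p ν →ₗ[ℂ] Lp ℂ p ν :=
    { toFun := fun f => (hmem f).toLp
      map_add' := by
        intro f g
        rw [← MemLp.toLp_add, MemLp.toLp_eq_toLp_iff]
        refine hca.ae_eq ?_
        filter_upwards [(main f).1, (main g).1] with x hx hx'
        rw [Pi.add_apply, conv, conv, conv, ← integral_add hx hx']
        refine integral_congr_ae ?_
        filter_upwards [hac.ae_eq (Lp.coeFn_add f g)] with y hy
        rw [hy, Pi.add_apply, mul_add]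
      map_smul' := by
        intro c f
        rw [RingHom.id_apply, ← MemLp.toLp_const_smul, MemLp.toLp_eq_toLp_iff]
        refine Filter.Eventually.of_forall fun x => ?_
        rw [Pi.smul_apply, conv, conv, smul_eq_mul, ← integral_const_mul]
        refine integral_congr_ae ?_
        filter_upwards [hac.ae_eq (Lp.coeFn_smul c f)] with y hy
        rw [hy, Pi.smul_apply, smul_eq_mul]
        ring }
  refine ⟨T₀.mkContinuous (∫⁻ x, ‖k x‖ₑ * θ x).toReal fun f => ?_, fun f hf => ?_⟩
  · rw [Lp.norm_def f, ← ENNReal.toReal_mul]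
    change ‖(hmem f).toLp‖ ≤ _
    rw [Lp.norm_toLp]
    exact ENNReal.toReal_mono (ENNReal.mul_ne_top hA (Lp.memLp f).2.ne) (main f).2.2
  · refine (hac.ae_eq (hmem (hf.toLp f)).coeFn_toLp).trans
      (Filter.Eventually.of_forall fun x => ?_)
    refine integral_congr_ae ?_
    filter_upwards [hac.ae_eq hf.coeFn_toLp] with y hy
    rw [hy]

end Convolution

/-! ### The radial multiplier -/

section Symbol

variable {W : ℝ} {φ : ℂ → ℂ} {E : Type*} [NormedAddCommGroup E]

theorem continuous_symbol (hW : 0 < W) (hφ : IsSymbolNegInfty W φ) :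
    Continuous fun ξ : E => φ ((2 * Real.pi * ‖ξ‖ : ℝ) : ℂ) :=
  (hφ 0).holomorphic.continuousOn.comp_continuous (by fun_prop) fun ξ => by simp [strip, hW]

theorem symbol_bounded (hW : 0 < W) (hφ : IsSymbolNegInfty W φ) :
    ∃ C : ℝ, ∀ ξ : E, ‖φ ((2 * Real.pi * ‖ξ‖ : ℝ) : ℂ)‖ ≤ C := by
  obtain ⟨C, hC⟩ := (hφ.rapidDecay 0).bound 0
  refine ⟨C, fun ξ => ?_⟩
  simpa using hC ((2 * Real.pi * ‖ξ‖ : ℝ) : ℂ) (by simp [strip, hW])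

variable [InnerProductSpace ℝ E]

theorem symbol_eq_compSqrt (hW : 0 < W) (he : ∀ z ∈ strip W, φ (-z) = φ z) (t : ℝ) :
    φ (t : ℂ) = compSqrt φ ((t ^ 2 : ℝ) : ℂ) := by
  rw [Complex.ofReal_pow, compSqrt_sq he (by simp [strip, hW])]

theorem symbol_eq_oscLine (hW : 0 < W) (he : ∀ z ∈ strip W, φ (-z) = φ z) (r : ℝ) (u ξ : E) :
    Complex.exp (Complex.I * r * (inner ℝ ((2 * Real.pi) • ξ) u : ℝ)) *
      φ ((2 * Real.pi * ‖ξ‖ : ℝ) : ℂ) =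
    oscLine 0 (compSqrt φ) r (‖(2 * Real.pi) • ξ‖ ^ 2 - inner ℝ ((2 * Real.pi) • ξ) u ^ 2)
      (inner ℝ ((2 * Real.pi) • ξ) u : ℝ) := by
  have h : ‖(2 * Real.pi) • ξ‖ = 2 * Real.pi * ‖ξ‖ := by
    rw [norm_smul, Real.norm_of_nonneg (by positivity)]
  rw [oscLine, symbol_eq_compSqrt hW he, pow_zero, one_mul, mul_comm, h]
  congr 2
  push_cast
  ring

theorem exists_unit_vector [Nontrivial E] (x : E) : ∃ u : E, ‖u‖ = 1 ∧ x = ‖x‖ • u := by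
  by_cases hx : x = 0
  · obtain ⟨u, hu⟩ := exists_norm_eq E zero_le_one
    exact ⟨u, hu, by simp [hx]⟩
  · have h : ‖x‖ ≠ 0 := norm_ne_zero_iff.2 hx
    exact ⟨‖x‖⁻¹ • x, by rw [norm_smul, norm_inv, norm_norm, inv_mul_cancel₀ h],
      by rw [smul_inv_smul₀ h]⟩

end Symbol

/-! ### The convolution kernel of a Fourier multiplier -/

section Fourier

open Module
open scoped SchwartzMap

variable {E : Type*} [NormedAddCommGroup E] [InnerProductSpace ℝ E] [FiniteDimensional ℝ E]
  [MeasurableSpace E] [BorelSpace E]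

theorem continuous_fourierInv_of_integrable {h : E → ℂ} (hh : Integrable h) :
    Continuous (𝓕⁻ h) :=
  VectorFourier.fourierIntegral_continuous (L := -innerₗ E) Real.continuous_fourierChar
    (continuous_inner.neg) hh

/-- On `L¹ ∩ L²` the inverse Fourier transform of `L²` is given by the Fourier integral. -/
theorem fourierInv_toLp_ae_eq {h : E → ℂ} (h1 : Integrable h) (h2 : MemLp h 2 volume) :
    ((𝓕⁻ (h2.toLp h) : Lp ℂ 2 (volume : Measure E)) : E → ℂ) =ᵐ[volume] 𝓕⁻ h := by
  refine ae_eq_of_integral_contDiff_smul_eq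
    ((Lp.memLp _).locallyIntegrable (by norm_num))
    (continuous_fourierInv_of_integrable h1).locallyIntegrable fun g hg hgc => ?_
  have hg1 : HasCompactSupport (Complex.ofRealCLM ∘ g) := hgc.comp_left rfl
  have hg2 := Complex.ofRealCLM.contDiff.comp hg
  set θ : 𝓢(E, ℂ) := hg1.toSchwartzMap hg2 with hθ
  have hθg : ∀ x, θ x = g x := fun x => rfl
  have e1 := congrArg (fun F : 𝓢'(E, ℂ) => F θ)
    (Lp.fourierInv_toTemperedDistribution_eq (h2.toLp h))
  simp only [TemperedDistribution.fourierInv_apply, Lp.toTemperedDistribution_apply] at e1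
  have e2 : ∫ x, (𝓕⁻ θ) x • (h2.toLp h : E → ℂ) x = ∫ x, (𝓕⁻ θ) x • h x := by
    refine integral_congr_ae ?_
    filter_upwards [h2.coeFn_toLp] with x hx
    rw [hx]
  have e3 : ∫ x, (𝓕⁻ θ) x • h x = ∫ x, θ x • (𝓕⁻ h) x := by
    rw [SchwartzMap.fourierInv_coe]
    have hflip : (-innerₗ E).flip = -innerₗ E := by
      ext v v'
      simp [real_inner_comm]
    have := VectorFourier.integral_fourierIntegral_smul_eq_flip (L := -innerₗ E)
      (μ := volume) (ν := volume) Real.continuous_fourierChar continuous_inner.neg θ.integrable h1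
    rw [hflip] at this
    exact this
  rw [e2, e3] at e1
  simpa only [hθg, Complex.real_smul, smul_eq_mul] using e1.symm

/-- Convolution with the inverse Fourier transform of `m` is the multiplier `m`; only Fubini's
theorem is needed, and not that `𝓕 (𝓕⁻ m) = m`. -/
theorem conv_fourierInv {m f : E → ℂ} (hm : Integrable m) (hf : Integrable f) (x : E) :
    conv (𝓕⁻ m) f x = 𝓕⁻ (fun ξ => m ξ * 𝓕 f ξ) x := by
  have hchar : Continuous fun z : E × E => Real.fourierChar (inner ℝ z.2 (x - z.1)) :=
    Real.continuous_fourierChar.comp (by fun_prop)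
  have hprod : Integrable (fun z : E × E =>
      Real.fourierChar (inner ℝ z.2 (x - z.1)) • (f z.1 * m z.2))
      ((volume : Measure E).prod volume) := by
    refine (hf.mul_prod hm).mono
      (hchar.aestronglyMeasurable.smul (hf.mul_prod hm).aestronglyMeasurable)
      (Filter.Eventually.of_forall fun z => ?_)
    rw [Circle.norm_smul]
  calc conv (𝓕⁻ m) f x
      = ∫ y, ∫ ξ, Real.fourierChar (inner ℝ ξ (x - y)) • (f y * m ξ) := by
        refine integral_congr_ae (Filter.Eventually.of_forall fun y => ?_)
        simp only
        rw [Real.fourierInv_eq, ← integral_mul_const]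
        refine integral_congr_ae (Filter.Eventually.of_forall fun ξ => ?_)
        simp only [Circle.smul_def, smul_eq_mul]
        ring
    _ = ∫ ξ, ∫ y, Real.fourierChar (inner ℝ ξ (x - y)) • (f y * m ξ) :=
        integral_integral_swap hprod
    _ = 𝓕⁻ (fun ξ => m ξ * 𝓕 f ξ) x := by
        rw [Real.fourierInv_eq]
        refine integral_congr_ae (Filter.Eventually.of_forall fun ξ => ?_)
        simp only
        rw [Real.fourier_eq, Circle.smul_def, smul_eq_mul, ← mul_assoc, ← integral_const_mul]
        refine integral_congr_ae (Filter.Eventually.of_forall fun y => ?_)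
        simp only [Circle.smul_def, smul_eq_mul]
        rw [inner_sub_right, sub_eq_add_neg, AddChar.map_add_eq_mul, real_inner_comm ξ y,
          Circle.coe_mul]
        ring

variable {W : ℝ} {φ : ℂ → ℂ}

theorem fourierInv_symbol_eq (hW : 0 < W) (hφ : IsSymbolNegInfty W φ) (r : ℝ) (u : E) :
    𝓕⁻ (fun ξ : E => φ ((2 * Real.pi * ‖ξ‖ : ℝ) : ℂ)) (r • u) =
      |((2 * Real.pi) ^ finrank ℝ E)⁻¹| • oscIntegral 0 (compSqrt φ) r u := by
  rw [oscIntegral, ← Measure.integral_comp_smul, Real.fourierInv_eq']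
  refine integral_congr_ae (Filter.Eventually.of_forall fun ξ => ?_)
  simp only
  rw [← symbol_eq_oscLine hW (hφ 0).even, smul_eq_mul, real_inner_smul_left,
    real_inner_smul_right]
  congr 2
  push_cast
  ring

variable [Nontrivial E]

theorem integrable_symbol (hW : 0 < W) (hφ : IsSymbolNegInfty W φ) :
    Integrable fun ξ : E => φ ((2 * Real.pi * ‖ξ‖ : ℝ) : ℂ) := by
  obtain ⟨u, hu, -⟩ := exists_unit_vector (0 : E)
  have h := (integrable_oscLine hW (rapidDecay_compSqrt hW hφ 1) 0 0 hu).comp_smul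
    (R := 2 * Real.pi) (by positivity)
  refine h.congr (Filter.Eventually.of_forall fun ξ => ?_)
  simp only
  rw [← symbol_eq_oscLine hW (hφ 0).even]
  simp

/-- The kernel of `φ(√Δ)` is `O(|x|^{-N} exp(-W|x|))` for every `N`. -/
theorem pow_mul_norm_fourierInv_symbol_le (hW : 0 < W) (hφ : IsSymbolNegInfty W φ) (N : ℕ) :
    ∃ C : ℝ, 0 ≤ C ∧ ∀ x : E,
      (1 + ‖x‖) ^ N * ‖𝓕⁻ (fun ξ : E => φ ((2 * Real.pi * ‖ξ‖ : ℝ) : ℂ)) x‖ ≤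
        C * Real.exp (-(W * ‖x‖)) := by
  have hψ := rapidDecay_compSqrt hW hφ
  obtain ⟨C₁, hC₁0, hC₁⟩ := pow_mul_norm_oscIntegral_le (E := E) hW hψ 0 0
  obtain ⟨C₂, hC₂0, hC₂⟩ := pow_mul_norm_oscIntegral_le (E := E) hW hψ 0 N
  set c : ℝ := |((2 * Real.pi) ^ finrank ℝ E)⁻¹| with hc
  refine ⟨c * (2 ^ (N - 1) * (C₁ + C₂)), by positivity, fun x => ?_⟩
  obtain ⟨u, hu, hx⟩ := exists_unit_vector x
  have h1 := hC₁ ‖x‖ u (norm_nonneg x) hu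
  have h2 := hC₂ ‖x‖ u (norm_nonneg x) hu
  rw [pow_zero, one_mul] at h1
  have h3 : (1 + ‖x‖) ^ N ≤ 2 ^ (N - 1) * (1 + ‖x‖ ^ N) := by
    simpa using add_pow_le zero_le_one (norm_nonneg x) N
  have h4 : ‖𝓕⁻ (fun ξ : E => φ ((2 * Real.pi * ‖ξ‖ : ℝ) : ℂ)) x‖ =
      c * ‖oscIntegral 0 (compSqrt φ) ‖x‖ u‖ := by
    conv_lhs => rw [hx]
    rw [fourierInv_symbol_eq hW hφ, norm_smul, Real.norm_of_nonneg (abs_nonneg _)]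
  rw [h4]
  set J := ‖oscIntegral 0 (compSqrt φ) ‖x‖ u‖
  have hJ : 0 ≤ J := norm_nonneg _
  calc (1 + ‖x‖) ^ N * (c * J) ≤ 2 ^ (N - 1) * (1 + ‖x‖ ^ N) * (c * J) := by gcongr
    _ = c * 2 ^ (N - 1) * (J + ‖x‖ ^ N * J) := by ring
    _ ≤ c * 2 ^ (N - 1) * (C₁ * Real.exp (-(W * ‖x‖)) + C₂ * Real.exp (-(W * ‖x‖))) := by gcongr
    _ = _ := by ring

/-- The polynomial gain makes the kernel integrable against the reciprocal of its own exponential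
decay: this is what the case `W = γ_p ρ` needs. -/
theorem lintegral_symbol_kernel_ne_top (hW : 0 < W) (hφ : IsSymbolNegInfty W φ) :
    ∫⁻ x : E, ‖𝓕⁻ (fun ξ : E => φ ((2 * Real.pi * ‖ξ‖ : ℝ) : ℂ)) x‖ₑ *
      ENNReal.ofReal (Real.exp (W * ‖x‖)) ≠ ∞ := by
  obtain ⟨C, hC0, hC⟩ := pow_mul_norm_fourierInv_symbol_le (E := E) hW hφ (finrank ℝ E + 1)
  have hint : Integrable fun x : E => C * (1 + ‖x‖) ^ (-((finrank ℝ E + 1 : ℕ) : ℝ)) :=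
    (integrable_one_add_norm (by push_cast; linarith)).const_mul C
  refine ne_top_of_le_ne_top hint.2.ne (lintegral_mono fun x => ?_)
  have hp : 0 < (1 + ‖x‖) ^ (finrank ℝ E + 1) := by positivity
  rw [← ofReal_norm, ← ofReal_norm, ← ENNReal.ofReal_mul (norm_nonneg _)]
  apply ENNReal.ofReal_le_ofReal
  beta_reduce
  rw [Real.rpow_neg (by positivity), Real.rpow_natCast, Real.norm_of_nonneg (by positivity),
    ← div_eq_mul_inv, le_div_iff₀ hp]
  calc _ = (1 + ‖x‖) ^ (finrank ℝ E + 1) *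
        ‖𝓕⁻ (fun ξ : E => φ ((2 * Real.pi * ‖ξ‖ : ℝ) : ℂ)) x‖ * Real.exp (W * ‖x‖) := by ring
    _ ≤ C * Real.exp (-(W * ‖x‖)) * Real.exp (W * ‖x‖) :=
        mul_le_mul_of_nonneg_right (hC x) (Real.exp_pos _).le
    _ = C := by rw [mul_assoc, ← Real.exp_add, neg_add_cancel, Real.exp_zero, mul_one]

end Fourier

/-! ### The functional calculus is a convolution -/

section FunctionalCalculus

variable {n : ℕ} {W : ℝ} {φ : ℂ → ℂ}

/-- The convolution kernel of `φ(√Δ)`. -/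
noncomputable def kernel (n : ℕ) (φ : ℂ → ℂ) : EuclideanSpace ℝ (Fin n) → ℂ :=
  𝓕⁻ (fun ξ : EuclideanSpace ℝ (Fin n) => φ ((2 * Real.pi * ‖ξ‖ : ℝ) : ℂ))

theorem memLp_symbol_mul (hW : 0 < W) (hφ : IsSymbolNegInfty W φ)
    (f : Lp ℂ 2 (volume : Measure (EuclideanSpace ℝ (Fin n)))) :
    MemLp (fun ξ => φ ((2 * Real.pi * ‖ξ‖ : ℝ) : ℂ) * f ξ) 2 volume := by
  obtain ⟨C, hC⟩ := symbol_bounded (E := EuclideanSpace ℝ (Fin n)) hW hφ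
  refine (Lp.memLp f).of_le_mul (c := C)
    ((continuous_symbol hW hφ).aestronglyMeasurable.mul (Lp.aestronglyMeasurable f))
    (Filter.Eventually.of_forall fun ξ => ?_)
  rw [norm_mul]
  exact mul_le_mul_of_nonneg_right (hC ξ) (norm_nonneg _)

theorem mem_domain (hW : 0 < W) (hφ : IsSymbolNegInfty W φ)
    (f : Lp ℂ 2 (volume : Measure (EuclideanSpace ℝ (Fin n)))) :
    f ∈ (funcSqrtLaplacian n φ).domain :=
  memLp_symbol_mul hW hφ (𝓕 f)

theorem funcSqrtLaplacian_apply (hW : 0 < W) (hφ : IsSymbolNegInfty W φ)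
    (f : Lp ℂ 2 (volume : Measure (EuclideanSpace ℝ (Fin n)))) :
    funcSqrtLaplacian n φ ⟨f, mem_domain hW hφ f⟩ =
      𝓕⁻ ((memLp_symbol_mul hW hφ (𝓕 f)).toLp) :=
  rfl

theorem exists_funcSqrtLaplacian_clm (hW : 0 < W) (hφ : IsSymbolNegInfty W φ) :
    ∃ S : Lp ℂ 2 (volume : Measure (EuclideanSpace ℝ (Fin n))) →L[ℂ]
        Lp ℂ 2 (volume : Measure (EuclideanSpace ℝ (Fin n))),
      ∀ f, S f = funcSqrtLaplacian n φ ⟨f, mem_domain hW hφ f⟩ := by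
  obtain ⟨C, hC⟩ := symbol_bounded (E := EuclideanSpace ℝ (Fin n)) hW hφ
  refine ⟨((funcSqrtLaplacian n φ).toFun ∘ₗ
    LinearMap.id.codRestrict (funcSqrtLaplacian n φ).domain (mem_domain hW hφ)).mkContinuous C
      fun f => ?_, fun f => rfl⟩
  change ‖funcSqrtLaplacian n φ ⟨f, mem_domain hW hφ f⟩‖ ≤ _
  rw [funcSqrtLaplacian_apply hW hφ]
  have h1 : ‖(𝓕⁻ ((memLp_symbol_mul hW hφ (𝓕 f)).toLp) :
      Lp ℂ 2 (volume : Measure (EuclideanSpace ℝ (Fin n))))‖ =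
      ‖(memLp_symbol_mul hW hφ (𝓕 f)).toLp‖ :=
    (Lp.fourierTransformₗᵢ (EuclideanSpace ℝ (Fin n)) ℂ).symm.norm_map _
  rw [h1, ← Lp.norm_fourier_eq f]
  refine Lp.norm_le_mul_norm_of_ae_le_mul ?_
  filter_upwards [(memLp_symbol_mul hW hφ (𝓕 f)).coeFn_toLp] with ξ hξ
  rw [hξ, norm_mul]
  exact mul_le_mul_of_nonneg_right (hC ξ) (norm_nonneg _)

variable [Nontrivial (EuclideanSpace ℝ (Fin n))]

theorem measurable_kernel (hW : 0 < W) (hφ : IsSymbolNegInfty W φ) : Measurable (kernel n φ) :=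
  (continuous_fourierInv_of_integrable (integrable_symbol hW hφ)).measurable

open scoped SchwartzMap in
theorem funcSqrtLaplacian_schwartz_ae_eq (hW : 0 < W) (hφ : IsSymbolNegInfty W φ)
    (f : 𝓢(EuclideanSpace ℝ (Fin n), ℂ)) :
    (funcSqrtLaplacian n φ ⟨f.toLp 2, mem_domain hW hφ _⟩ : EuclideanSpace ℝ (Fin n) → ℂ)
      =ᵐ[volume] conv (kernel n φ) f := by
  have hm := integrable_symbol (E := EuclideanSpace ℝ (Fin n)) hW hφ
  set h : EuclideanSpace ℝ (Fin n) → ℂ := fun ξ => φ ((2 * Real.pi * ‖ξ‖ : ℝ) : ℂ) * 𝓕 (⇑f) ξ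
    with hh
  have hae : (fun ξ => φ ((2 * Real.pi * ‖ξ‖ : ℝ) : ℂ) *
      (𝓕 (f.toLp 2) : Lp ℂ 2 (volume : Measure (EuclideanSpace ℝ (Fin n)))) ξ) =ᵐ[volume] h := by
    rw [SchwartzMap.toLp_fourier_eq]
    filter_upwards [(𝓕 f).coeFn_toLp 2] with ξ hξ
    rw [hξ, hh, ← SchwartzMap.fourier_coe]
  have h2 : MemLp h 2 volume := (memLp_congr_ae hae).1 (memLp_symbol_mul hW hφ _)
  have h1 : Integrable h := by
    obtain ⟨C, hC⟩ := symbol_bounded (E := EuclideanSpace ℝ (Fin n)) hW hφ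
    rw [hh, ← SchwartzMap.fourier_coe]
    exact (𝓕 f).integrable.bdd_mul (continuous_symbol hW hφ).aestronglyMeasurable
      (Filter.Eventually.of_forall hC)
  rw [funcSqrtLaplacian_apply hW hφ, (MemLp.toLp_eq_toLp_iff _ h2).2 hae]
  filter_upwards [fourierInv_toLp_ae_eq h1 h2] with x hx
  rw [hx, kernel, conv_fourierInv hm f.integrable]

/-- Both sides are bounded on `L²` and agree on Schwartz functions. -/
theorem funcSqrtLaplacian_ae_eq_conv (hW : 0 < W) (hφ : IsSymbolNegInfty W φ)
    {f : EuclideanSpace ℝ (Fin n) → ℂ} (hf : MemLp f 2 volume) :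
    (funcSqrtLaplacian n φ ⟨hf.toLp f, mem_domain hW hφ _⟩ : EuclideanSpace ℝ (Fin n) → ℂ)
      =ᵐ[volume] conv (kernel n φ) f := by
  obtain ⟨S, hS⟩ := exists_funcSqrtLaplacian_clm (n := n) hW hφ
  obtain ⟨T, hT⟩ := exists_convolution_operator (p := 2)
    (ν := (volume : Measure (EuclideanSpace ℝ (Fin n)))) (w := 1)
    (measurable_kernel hW hφ) (θ := fun x => ENNReal.ofReal (Real.exp (W * ‖x‖))) (by fun_prop)
    (lintegral_symbol_kernel_ne_top hW hφ) measurable_one (by simp) (by simp)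
    (by
      refine Filter.Eventually.of_forall fun x => Filter.Eventually.of_forall fun y => ?_
      rw [Pi.one_apply, Pi.one_apply, mul_one]
      refine ENNReal.one_le_rpow ?_ (by simp)
      rw [ENNReal.one_le_ofReal]
      exact Real.one_le_exp (by positivity))
    withDensity_one.symm
  have hST : (S : _ → Lp ℂ 2 (volume : Measure (EuclideanSpace ℝ (Fin n)))) = T := by
    refine (SchwartzMap.denseRange_toLpCLM (p := 2) (μ := volume)
      ENNReal.ofNat_ne_top).equalizer S.continuous T.continuous (funext fun g => ?_)
    refine Lp.ext ?_
    simp only [Function.comp_apply, SchwartzMap.toLpCLM_apply]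
    rw [hS]
    exact (funcSqrtLaplacian_schwartz_ae_eq hW hφ g).trans (hT g (g.memLp 2 volume)).symm
  rw [← hS, hST]
  exact hT f hf

end FunctionalCalculus

/-! ### Density of Schwartz functions -/

section Density

variable {n : ℕ} {ρ : ℝ} {p : ℝ≥0∞}

variable [Nontrivial (EuclideanSpace ℝ (Fin n))]

theorem weightedMeasure_le (hn : 1 ≤ n) (hρ : 0 < ρ) :
    ∃ C : ℝ≥0∞, C ≠ ∞ ∧ weightedMeasure n ρ p ≤ C • volume := by
  obtain ⟨C, -, hC⟩ := weight_le (p := p) hn hρ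
  refine ⟨ENNReal.ofReal C, ENNReal.ofReal_ne_top, ?_⟩
  rw [weightedMeasure, ← withDensity_const]
  refine withDensity_mono ?_
  filter_upwards [Measure.ae_ne volume (0 : EuclideanSpace ℝ (Fin n))] with x hx
  exact ENNReal.ofReal_le_ofReal (hC x hx)

theorem isFiniteMeasureOnCompacts_weightedMeasure (hn : 1 ≤ n) (hρ : 0 < ρ) :
    IsFiniteMeasureOnCompacts (weightedMeasure n ρ p) := by
  obtain ⟨C, hC, hle⟩ := weightedMeasure_le (p := p) hn hρ
  refine ⟨fun K hK => (hle K).trans_lt ?_⟩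
  rw [Measure.smul_apply, smul_eq_mul]
  exact ENNReal.mul_lt_top hC.lt_top hK.measure_lt_top

theorem hasTemperateGrowth_weightedMeasure (hn : 1 ≤ n) (hρ : 0 < ρ) :
    (weightedMeasure n ρ p).HasTemperateGrowth := by
  obtain ⟨C, hC, hle⟩ := weightedMeasure_le (p := p) hn hρ
  obtain ⟨N, hN⟩ := Measure.HasTemperateGrowth.exists_integrable
    (μ := (volume : Measure (EuclideanSpace ℝ (Fin n))))
  exact ⟨N, (hN.smul_measure hC).mono_measure hle⟩

end Density

end WeightedMultiplier

open WeightedMultiplier in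
theorem theorem2p6 (n : ℕ) (hn : 1 ≤ n) (ρ : ℝ) (hρ : 0 < ρ)
    (p : ℝ≥0∞) [Fact (1 ≤ p)] (hp : p ≠ ∞)
    (W : ℝ) (hW₀ : 0 < W) (hW : WeightedMultiplier.gammaExp p * ρ ≤ W)
    (φ : ℂ → ℂ) (hφ : WeightedMultiplier.IsSymbolNegInfty W φ) :
    ∃! T : Lp ℂ p (WeightedMultiplier.weightedMeasure n ρ p) →L[ℂ]
        Lp ℂ p (WeightedMultiplier.weightedMeasure n ρ p),
      ∀ (f : EuclideanSpace ℝ (Fin n) → ℂ) (hf₂ : MemLp f 2 volume)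
        (hfp : MemLp f p (WeightedMultiplier.weightedMeasure n ρ p)),
        ∃ hd : hf₂.toLp f ∈ (WeightedMultiplier.funcSqrtLaplacian n φ).domain,
          (T (hfp.toLp f) : EuclideanSpace ℝ (Fin n) → ℂ) =ᵐ[volume]
            WeightedMultiplier.funcSqrtLaplacian n φ ⟨hf₂.toLp f, hd⟩ := by
  have : Nonempty (Fin n) := ⟨⟨0, hn⟩⟩
  have : Nontrivial (EuclideanSpace ℝ (Fin n)) := inferInstance
  have hne : ∀ᵐ x : EuclideanSpace ℝ (Fin n), x ≠ 0 := Measure.ae_ne volume 0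
  obtain ⟨T, hT⟩ := exists_convolution_operator (p := p) (ν := weightedMeasure n ρ p)
    (w := fun x => ENNReal.ofReal (weight n ρ p x)) (measurable_kernel hW₀ hφ)
    (θ := fun x => ENNReal.ofReal (Real.exp (W * ‖x‖))) (by fun_prop)
    (lintegral_symbol_kernel_ne_top hW₀ hφ) measurable_weight.ennreal_ofReal
    (by
      filter_upwards [hne] with x hx
      exact (ENNReal.ofReal_pos.2 (weight_pos hn hρ hx)).ne')
    hp
    (by
      filter_upwards [hne] with x hx
      filter_upwards [hne] with y hy
      rw [ENNReal.ofReal_rpow_of_pos (Real.exp_pos _), ← ENNReal.ofReal_mul (by positivity)]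
      refine ENNReal.ofReal_le_ofReal ((weight_le_exp_mul hn hρ hx hy).trans ?_)
      have := (weight_pos (p := p) hn hρ hy).le
      gcongr)
    rfl
  refine ⟨T, fun f hf₂ hfp => ⟨mem_domain hW₀ hφ _, ?_⟩, fun T' hT' => ?_⟩
  · exact (hT f hfp).trans (funcSqrtLaplacian_ae_eq_conv hW₀ hφ hf₂).symm
  · have := isFiniteMeasureOnCompacts_weightedMeasure (p := p) hn hρ
    have := hasTemperateGrowth_weightedMeasure (p := p) hn hρ
    refine DFunLike.coe_injective ((SchwartzMap.denseRange_toLpCLM (F := ℂ) (p := p)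
      (μ := weightedMeasure n ρ p) hp).equalizer T'.continuous T.continuous (funext fun g => ?_))
    obtain ⟨hd, h1⟩ := hT' g (g.memLp 2 volume) (g.memLp p _)
    have h2 := (h1.trans (funcSqrtLaplacian_ae_eq_conv hW₀ hφ (g.memLp 2 volume))).trans
      (hT g (g.memLp p _)).symm
    exact Lp.ext ((withDensity_absolutelyContinuous _ _).ae_eq h2)
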